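/- Let $R$ be a commutative ring with identity and let $C$ be a semidualizing $R$-module, i.e. $C$ has a projective resolution by finitely generated projective modules, the homothety map $R\to\operatorname{Hom}_R(C,C)$ is an isomorphism, and $\operatorname{Ext}^n_R(C,C)=0$ for all $n\ge 1$. Let $\mathrm{Ch}(R)$ be the abelian category of ($\mathbb Z$-indexed) complexes of $R$-modules. For a class $\mathcal X$ of $R$-modules, closed under isomorphism, let $\widetilde{\mathcal X}$ be the class of exact complexes all of whose cycle modules lie in $\mathcal X$. Call the complexes in $\widetilde{\mathcal X}$ projective, $C$-projective or $C$-flat when $\mathcal X$ consists, respectively, of the projective modules, of the modules isomorphic to $C\otimes_R P$ with $P$ projective, or of the modules isomorphic to $C\otimes_R F$ with $F$ flat. A complex $X$ is called $D_C$-projective if there is an exact sequence in $\mathrm{Ch}(R)$ $$\cdots\to P_1\to P_0\xrightarrow{f_0}Q_{-1}\to Q_{-2}\to\cdots$$ with all $P_i$ projective complexes and all $Q_i$ $C$-projective complexes, which remains exact after applying $\operatorname{Hom}_{\mathrm{Ch}(R)}(-,H)$ for every $C$-flat complex $H$, and such that $X\cong\operatorname{Im} f_0$. Then the class of $D_C$-projective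 complexes is projectively resolving: it contains all projective objects of $\mathrm{Ch}(R)$, and for every short exact sequence $0\to X'\to X\to X''\to 0$ in $\mathrm{Ch}(R)$ with $X''$ $D_C$-projective, $X'$ is $D_C$-projective if and only if $X$ is $D_C$-projective. Moreover, it contains all projective complexes in the above sense. -/

import Mathlib

open CategoryTheory
open scoped TensorProduct

universe v w u

section AbelianCategories

variable {A : Type w} [Category.{v} A] [Abelian A]

/-- A class `𝓧` of objects of an abelian category is projectively resolving if it contains all
projective objects and, for every short exact sequence `0 ⟶ X' ⟶ X ⟶ X'' ⟶ 0` with `X''` in `𝓧`,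
`X` is in `𝓧` if and only if `X'` is. -/
def IsProjectivelyResolving (𝓧 : ObjectProperty A) : Prop :=
  (∀ P : A, Projective P → 𝓧 P) ∧
    ∀ S : ShortComplex A, S.ShortExact → 𝓧 S.X₃ → (𝓧 S.X₂ ↔ 𝓧 S.X₁)

/-- The sequence `⋯ ⟶ L₁ ⟶ L₀ ⟶ L₋₁ ⟶ ⋯` is `Hom(-, 𝓑)`-exact: for every `B` in `𝓑` the sequence
of groups `⋯ ⟶ Hom(L₋₁, B) ⟶ Hom(L₀, B) ⟶ Hom(L₁, B) ⟶ ⋯` is exact. -/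
def IsHomExact (𝓑 : ObjectProperty A) (L : ChainComplex A ℤ) : Prop :=
  ∀ B : A, 𝓑 B → ∀ i : ℤ,
    Function.Exact (fun g : L.X (i - 1) ⟶ B => L.d i (i - 1) ≫ g)
      (fun g : L.X i ⟶ B => L.d (i + 1) i ≫ g)

end AbelianCategories

section Modules

variable (R : Type u) [CommRing R]

/-- The class `𝓟(R)` of projective `R`-modules. -/
def projectiveModules : ObjectProperty (ModuleCat.{u} R) :=
  fun M => Module.Projective R M

variable (C : Type u) [AddCommGroup C] [Module R C]

/-- `C` is a semidualizing `R`-module. -/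
structure IsSemidualizing : Prop where
  /-- `C` has a projective resolution by finitely generated projective modules. -/
  exists_finite_resolution : ∃ P : ProjectiveResolution (ModuleCat.of R C),
    ∀ n, Module.Finite R (P.complex.X n)
  /-- The homothety map `R ⟶ Hom_R(C, C)` is an isomorphism. -/
  homothety_bijective : Function.Bijective (LinearMap.lsmul R C)
  /-- `Ext_R^n(C, C) = 0` for all `n ≥ 1`. -/
  ext_subsingleton : ∀ n : ℕ, 1 ≤ n →
    Subsingleton (Abelian.Ext.{u} (ModuleCat.of R C) (ModuleCat.of R C) n)

/-- The class `𝓟_C(R)` of modules isomorphic to `C ⊗ P` with `P` projective. -/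
def cProjectiveModules : ObjectProperty (ModuleCat.{u} R) :=
  fun M => ∃ P : ModuleCat.{u} R, Module.Projective R P ∧ Nonempty (M ≃ₗ[R] C ⊗[R] P)

/-- The class `𝓕_C(R)` of modules isomorphic to `C ⊗ F` with `F` flat. -/
def cFlatModules : ObjectProperty (ModuleCat.{u} R) :=
  fun M => ∃ F : ModuleCat.{u} R, Module.Flat R F ∧ Nonempty (M ≃ₗ[R] C ⊗[R] F)

variable {R} in
/-- The class of `𝓧`-complexes: exact complexes of `R`-modules all of whose cycle modules lie
in `𝓧`. -/
def complexesOf (𝓧 : ObjectProperty (ModuleCat.{u} R)) :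
    ObjectProperty (ChainComplex (ModuleCat.{u} R) ℤ) :=
  fun X => X.Acyclic ∧ ∀ i : ℤ, 𝓧 (X.cycles i)

/-- The class of `D_C`-projective complexes: complexes isomorphic to the image of `E₀ ⟶ E₋₁` for
some exact sequence of complexes `⋯ ⟶ E₁ ⟶ E₀ ⟶ E₋₁ ⟶ ⋯`, with `Eᵢ` a projective complex for
`i ≥ 0` and a `C`-projective complex for `i < 0`, that is `Hom(-, H)`-exact for all `C`-flat
complexes `H`. -/
def dcProjectiveComplexes : ObjectProperty (ChainComplex (ModuleCat.{u} R) ℤ) :=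
  fun X => ∃ E : ChainComplex (ChainComplex (ModuleCat.{u} R) ℤ) ℤ,
    E.Acyclic ∧
    IsHomExact (complexesOf (cFlatModules R C)) E ∧
    (∀ i : ℤ, 0 ≤ i → complexesOf (projectiveModules R) (E.X i)) ∧
    (∀ i : ℤ, i < 0 → complexesOf (cProjectiveModules R C) (E.X i)) ∧
    Nonempty (X ≅ Limits.image (E.d 0 (-1)))

end Modules

/-! A complex X is D_C-projective exactly when Ext^n(X, H) = 0 for all n ≥ 1 and all C-flat H, and X
has a coresolution by C-projective complexes whose cosyzygies satisfy the same vanishing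
(`coresolvedClass`, `IsSemidualizing.dcProjectiveComplexes_iff`). The projective half of the
defining sequence adds no condition, since any projective resolution of X serves. The equivalence is
dimension shifting, once projective and C-projective complexes are known to be Ext-orthogonal to
C-flat ones.

Closure under extensions is then a horseshoe argument: C-projectives are C-flat, so Ext^1(X'', Q) =
0 and a map from X' to a C-projective Q extends to X (`coresolvedClass.middle`). If X and X'' are in
the class, embed X in a C-projective Q. The quotient Q/X' is an extension of Q/X by X'', hence in
the class, and so X' is too (`coresolvedClass.left`).

The rest reduces to modules, because projective and C-projective complexes are sums of disks and Ext
out of such a sum can be tested degreewise. Let K run through C and its syzygies in a resolution by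
finitely generated projectives, P be projective and F flat. The isomorphism Hom(K, C) ⊗ F ≅ Hom(K, C
⊗ F) yields Ext^n(C ⊗ P, C ⊗ F) = 0 for n ≥ 1. Applying Hom(-, C) ⊗ P to the resolution coresolves P
≅ Hom(C, C) ⊗ P by C-projectives. The cosyzygies Hom(K, C) ⊗ P are orthogonal to C ⊗ F because K ⊗ F
⟶ Hom(Hom(K, C), C ⊗ F) is bijective, a property inherited by each successive syzygy
(`tensorBidual_bijective_of_exact`). -/

/-! ### Short exact sequences of cokernels -/

section Horseshoe

variable {A : Type w} [Category.{v} A] [Abelian A]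

open Limits

/-- The nine lemma for the horseshoe construction: compatible monomorphisms into objects of
`𝓠` give a short exact sequence of cokernels. -/
lemma shortExact_cokernel_horseshoe {S : ShortComplex A} (hS : S.ShortExact) {Q₁ Q₃ : A}
    (h : S.X₂ ⟶ Q₁) (f₃ : S.X₃ ⟶ Q₃) [Mono (S.f ≫ h)] [Mono f₃] :
    Mono (biprod.lift h (S.g ≫ f₃)) ∧
    ∃ (a : cokernel (S.f ≫ h) ⟶ cokernel (biprod.lift h (S.g ≫ f₃)))
      (b : cokernel (biprod.lift h (S.g ≫ f₃)) ⟶ cokernel f₃) (w : a ≫ b = 0),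
      (ShortComplex.mk a b w).ShortExact := by
  have := hS.mono_f
  have := hS.epi_g
  let φ := biprod.lift h (S.g ≫ f₃)
  let T : ShortComplex A := ShortComplex.mk (biprod.inl : Q₁ ⟶ Q₁ ⊞ Q₃) biprod.snd (by simp)
  have hT : T.ShortExact := (ShortComplex.Splitting.ofHasBinaryBiproduct Q₁ Q₃).shortExact
  have w₁ : S.f ≫ φ = (S.f ≫ h) ≫ biprod.inl := by
    ext <;> simp [φ]
  have w₂ : φ ≫ biprod.snd = S.g ≫ f₃ := by simp [φ]
  let I : ShortComplex.SnakeInput A :=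
    { L₀ := ShortComplex.mk (kernel.map (S.f ≫ h) φ S.f biprod.inl w₁.symm)
        (kernel.map φ f₃ S.g biprod.snd w₂) (by ext; simp)
      L₁ := S
      L₂ := T
      L₃ := ShortComplex.mk (cokernel.map (S.f ≫ h) φ S.f biprod.inl w₁.symm)
        (cokernel.map φ f₃ S.g biprod.snd w₂) (by ext; simp)
      v₀₁ := { τ₁ := kernel.ι _, τ₂ := kernel.ι _, τ₃ := kernel.ι _ }
      v₁₂ := { τ₁ := S.f ≫ h, τ₂ := φ, τ₃ := f₃, comm₁₂ := w₁.symm, comm₂₃ := w₂ }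
      v₂₃ := { τ₁ := cokernel.π _, τ₂ := cokernel.π _, τ₃ := cokernel.π _ }
      w₀₂ := by ext <;> simp
      w₁₃ := by ext <;> simp
      h₀ := by
        apply ShortComplex.isLimitOfIsLimitπ <;>
          apply (KernelFork.isLimitMapConeEquiv _ _).2
        · exact kernelIsKernel _
        · exact kernelIsKernel _
        · exact kernelIsKernel _
      h₃ := by
        apply ShortComplex.isColimitOfIsColimitπ <;>
          apply (CokernelCofork.isColimitMapCoconeEquiv _ _).2
        · exact cokernelIsCokernel _
        · exact cokernelIsCokernel _
        · exact cokernelIsCokernel _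
      L₁_exact := hS.exact
      epi_L₁_g := hS.epi_g
      L₂_exact := hT.exact
      mono_L₂_f := hT.mono_f }
  -- The connecting morphism of the snake starts at ker f₃ = 0, so the first map of cokernels is
  -- mono.
  have hz : IsZero I.L₀.X₃ := isZero_kernel_of_mono f₃
  refine ⟨?_, I.L₃.f, I.L₃.g, I.L₃.zero, ?_⟩
  · refine Preadditive.mono_of_cancel_zero φ fun g hg => ?_
    have hg₁ : g ≫ h = 0 := by simpa [φ] using hg =≫ biprod.fst
    have hg₃ : g ≫ S.g = 0 := by
      rw [← cancel_mono f₃]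
      simpa [φ] using hg =≫ biprod.snd
    rw [← hS.exact.lift_f g hg₃]
    have : hS.exact.lift g hg₃ = 0 := by
      rw [← cancel_mono (S.f ≫ h), ← Category.assoc, hS.exact.lift_f, hg₁, zero_comp]
    rw [this, zero_comp]
  · have : Mono I.L₃.f := I.L₂'_exact.mono_g (hz.eq_of_src _ _)
    have : Epi I.L₃.g := inferInstanceAs (Epi (cokernel.map φ f₃ S.g biprod.snd w₂))
    exact { exact := I.L₃_exact }

/-- The third isomorphism theorem, as a short exact sequence of cokernels. -/
lemma shortExact_cokernel_comp {X Y Z : A} (f : X ⟶ Y) (g : Y ⟶ Z) [Mono g] :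
    (ShortComplex.mk (cokernel.map f (f ≫ g) (𝟙 _) g (by simp))
      (cokernel.map (f ≫ g) g f (𝟙 _) (by simp)) (by ext; simp)).ShortExact := by
  let I := kernelCokernelCompSequence.snakeInput f g
  have hz : IsZero I.L₀.X₃ := isZero_kernel_of_mono g
  exact
    { exact := I.L₃_exact
      mono_f := I.L₂'_exact.mono_g (hz.eq_of_src _ _)
      epi_g := inferInstanceAs (Epi (cokernel.map (f ≫ g) g f (𝟙 _) (by simp))) }

end Horseshoe

/-! ### Ext-orthogonality and coresolved classes -/

section ExtVanishing

open Abelian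

variable {A : Type w} [Category.{v} A] [Abelian A] [HasExt.{u} A]

namespace CategoryTheory.ShortComplex.ShortExact

variable {S : ShortComplex A}

lemma subsingleton_ext_middle (hS : S.ShortExact) {Y : A} {n : ℕ}
    (h₁ : Subsingleton (Ext S.X₁ Y n))
    (h₃ : Subsingleton (Ext S.X₃ Y n)) : Subsingleton (Ext S.X₂ Y n) := by
  refine subsingleton_of_forall_eq 0 fun e => ?_
  obtain ⟨x, rfl⟩ := Ext.contravariant_sequence_exact₂ hS Y e (Subsingleton.elim _ _)
  rw [Subsingleton.elim x 0, Ext.comp_zero]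

lemma subsingleton_ext_left (hS : S.ShortExact) {Y : A} {n : ℕ}
    (h₂ : Subsingleton (Ext S.X₂ Y n))
    (h₃ : Subsingleton (Ext S.X₃ Y (n + 1))) : Subsingleton (Ext S.X₁ Y n) := by
  refine subsingleton_of_forall_eq 0 fun e => ?_
  obtain ⟨x, rfl⟩ := Ext.contravariant_sequence_exact₁ hS Y e (add_comm 1 n)
    (Subsingleton.elim _ _)
  rw [Subsingleton.elim x 0, Ext.comp_zero]

lemma subsingleton_ext_right (hS : S.ShortExact) {Y : A} {n : ℕ}
    (h₁ : Subsingleton (Ext S.X₁ Y n))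
    (h₂ : Subsingleton (Ext S.X₂ Y (n + 1))) : Subsingleton (Ext S.X₃ Y (n + 1)) := by
  refine subsingleton_of_forall_eq 0 fun e => ?_
  obtain ⟨x, rfl⟩ := Ext.contravariant_sequence_exact₃ hS Y e (Subsingleton.elim _ _)
    (add_comm 1 n)
  rw [Subsingleton.elim x 0, Ext.comp_zero]

/-- A class in Ext^1(X₃, Y) that dies on X₂ is the pushout of the given extension along some X₁ ⟶ Y.
It vanishes as soon as that map extends to X₂. -/
lemma subsingleton_ext_one_right (hS : S.ShortExact) {Y : A}
    (h : ∀ f : S.X₁ ⟶ Y, ∃ g : S.X₂ ⟶ Y, S.f ≫ g = f)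
    (h₂ : Subsingleton (Ext S.X₂ Y 1)) : Subsingleton (Ext S.X₃ Y 1) := by
  refine subsingleton_of_forall_eq 0 fun e => ?_
  obtain ⟨x, rfl⟩ := Ext.contravariant_sequence_exact₃ hS Y e (Subsingleton.elim _ _)
    (add_zero 1)
  obtain ⟨f, rfl⟩ := (Ext.mk₀_bijective _ _).2 x
  obtain ⟨g, rfl⟩ := h f
  rw [← Ext.mk₀_comp_mk₀, ← Ext.comp_assoc (a₁₂ := 1) (a₂₃ := 0) (h := by simp) (h₁₂ := by simp)
    (h₂₃ := by simp), hS.extClass_comp, Ext.zero_comp]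

lemma exists_extension (hS : S.ShortExact) {Y : A} (h₃ : Subsingleton (Ext S.X₃ Y 1))
    (f : S.X₁ ⟶ Y) :
    ∃ g : S.X₂ ⟶ Y, S.f ≫ g = f := by
  obtain ⟨x, hx⟩ := Ext.contravariant_sequence_exact₁ hS Y (Ext.mk₀ f) (add_zero 1)
    (Subsingleton.elim _ _)
  obtain ⟨g, rfl⟩ := (Ext.mk₀_bijective _ _).2 x
  exact ⟨g, (Ext.mk₀_bijective _ _).1 (by rw [← hx, Ext.mk₀_comp_mk₀])⟩

lemma subsingleton_ext_to_middle (hS : S.ShortExact) {X : A} {n : ℕ}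
    (h₁ : Subsingleton (Ext X S.X₁ n))
    (h₃ : Subsingleton (Ext X S.X₃ n)) : Subsingleton (Ext X S.X₂ n) := by
  refine subsingleton_of_forall_eq 0 fun e => ?_
  obtain ⟨x, rfl⟩ := Ext.covariant_sequence_exact₂ X hS e (Subsingleton.elim _ _)
  rw [Subsingleton.elim x 0, Ext.zero_comp]

end CategoryTheory.ShortComplex.ShortExact

lemma CategoryTheory.Retract.subsingleton_ext {X X' Y : A} (h : Retract X' X) {n : ℕ}
    (hX : Subsingleton (Ext X Y n)) : Subsingleton (Ext X' Y n) := by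
  refine subsingleton_of_forall_eq 0 fun e => ?_
  rw [← Ext.mk₀_id_comp e, ← h.retract, ← Ext.mk₀_comp_mk₀_assoc,
    Subsingleton.elim ((Ext.mk₀ h.r).comp e (zero_add n)) 0, Ext.comp_zero]

lemma CategoryTheory.Retract.subsingleton_ext_to {X Y Y' : A} (h : Retract Y' Y) {n : ℕ}
    (hX : Subsingleton (Ext X Y n)) : Subsingleton (Ext X Y' n) := by
  refine subsingleton_of_forall_eq 0 fun e => ?_
  rw [← Ext.comp_mk₀_id e, ← h.retract, ← Ext.mk₀_comp_mk₀,
    ← Ext.comp_assoc (a₁₂ := n) (h := by simp) (h₁₂ := by simp) (h₂₃ := by simp),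
    Subsingleton.elim (e.comp (Ext.mk₀ h.i) (add_zero n)) 0, Ext.zero_comp]

/-- The class of objects `X` with `Ext^n(X, H) = 0` for all `n ≥ 1` and all `H` in `𝓗`. -/
def extOrthogonal (𝓗 : ObjectProperty A) : ObjectProperty A :=
  fun X => ∀ H, 𝓗 H → ∀ n : ℕ, Subsingleton (Ext X H (n + 1))

/-- The largest class of objects orthogonal to `𝓗` in which every object embeds in an object
of `𝓠` with cokernel in the class. -/
def coresolvedClass (𝓠 𝓗 : ObjectProperty A) : ObjectProperty A :=
  fun X => ∃ 𝓦 : ObjectProperty A, 𝓦 ≤ extOrthogonal 𝓗 ∧ 𝓦 X ∧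
    ∀ W, 𝓦 W → ∃ (Q W' : A) (f : W ⟶ Q) (g : Q ⟶ W') (h : f ≫ g = 0),
      (ShortComplex.mk f g h).ShortExact ∧ 𝓠 Q ∧ 𝓦 W'

variable {𝓠 𝓗 : ObjectProperty A}

lemma extOrthogonal_of_projective (P : A) [Projective P] : extOrthogonal 𝓗 P :=
  fun H _ n => Ext.subsingleton_of_projective P H n

lemma coresolvedClass_le : coresolvedClass 𝓠 𝓗 ≤ extOrthogonal 𝓗 :=
  fun _ ⟨_, h, hX, _⟩ => h _ hX

lemma coresolvedClass.exists_shortExact {X : A} (hX : coresolvedClass 𝓠 𝓗 X) :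
    ∃ (Q X' : A) (f : X ⟶ Q) (g : Q ⟶ X') (h : f ≫ g = 0),
      (ShortComplex.mk f g h).ShortExact ∧ 𝓠 Q ∧ coresolvedClass 𝓠 𝓗 X' := by
  obtain ⟨𝓦, h𝓦, hX, H⟩ := hX
  obtain ⟨Q, W', f, g, h, hS, hQ, hW'⟩ := H X hX
  exact ⟨Q, W', f, g, h, hS, hQ, 𝓦, h𝓦, hW', H⟩

lemma extOrthogonal_middle {S : ShortComplex A} (hS : S.ShortExact)
    (h₁ : extOrthogonal 𝓗 S.X₁) (h₃ : extOrthogonal 𝓗 S.X₃) : extOrthogonal 𝓗 S.X₂ :=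
  fun H hH n => hS.subsingleton_ext_middle (h₁ H hH n) (h₃ H hH n)

lemma extOrthogonal_left {S : ShortComplex A} (hS : S.ShortExact)
    (h₂ : extOrthogonal 𝓗 S.X₂) (h₃ : extOrthogonal 𝓗 S.X₃) : extOrthogonal 𝓗 S.X₁ :=
  fun H hH n => hS.subsingleton_ext_left (h₂ H hH n) (h₃ H hH (n + 1))

lemma extOrthogonal_right {S : ShortComplex A} (hS : S.ShortExact)
    (h₁ : extOrthogonal 𝓗 S.X₁) (h₂ : extOrthogonal 𝓗 S.X₂)
    (h : ∀ H, 𝓗 H → ∀ f : S.X₁ ⟶ H, ∃ g : S.X₂ ⟶ H, S.f ≫ g = f) : extOrthogonal 𝓗 S.X₃ := by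
  intro H hH n
  cases n with
  | zero => exact hS.subsingleton_ext_one_right (h H hH) (h₂ H hH 0)
  | succ n => exact hS.subsingleton_ext_right (h₁ H hH n) (h₂ H hH (n + 1))

lemma extOrthogonal_of_iso {X Y : A} (e : X ≅ Y) (hY : extOrthogonal 𝓗 Y) :
    extOrthogonal 𝓗 X :=
  fun H hH n => e.retract.subsingleton_ext (hY H hH n)

namespace coresolvedClass

/-- Adjoining X to the largest class leaves every member with an embedding of the required kind, so
maximality already puts X in it. -/
lemma of_shortExact {X Q Y : A} {f : X ⟶ Q} {g : Q ⟶ Y} {w : f ≫ g = 0}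
    (hS : (ShortComplex.mk f g w).ShortExact) (h₁ : extOrthogonal 𝓗 X)
    (h₂ : 𝓠 Q) (h₃ : coresolvedClass 𝓠 𝓗 Y) : coresolvedClass 𝓠 𝓗 X := by
  refine ⟨fun W => W = X ∨ coresolvedClass 𝓠 𝓗 W, ?_, .inl rfl, ?_⟩
  · rintro W (rfl | hW)
    · exact h₁
    · exact coresolvedClass_le _ hW
  · rintro W (rfl | hW)
    · exact ⟨Q, Y, f, g, w, hS, h₂, .inr h₃⟩
    · obtain ⟨Q, W', f, g, h, hS, hQ, hW'⟩ := hW.exists_shortExact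
      exact ⟨Q, W', f, g, h, hS, hQ, .inr hW'⟩

lemma of_iso {X Y : A} (e : X ≅ Y) (hY : coresolvedClass 𝓠 𝓗 Y) : coresolvedClass 𝓠 𝓗 X := by
  obtain ⟨Q, Y', f, g, h, hS, hQ, hY'⟩ := hY.exists_shortExact
  have hS' : (ShortComplex.mk (e.hom ≫ f) g (by simp [h])).ShortExact :=
    ShortComplex.shortExact_of_iso
      (ShortComplex.isoMk (S₁ := ShortComplex.mk f g h) e.symm (Iso.refl _) (Iso.refl _)
        (by simp) (by simp)) hS
  exact of_shortExact hS' (extOrthogonal_of_iso e (coresolvedClass_le _ hY)) hQ hY'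

open Limits

lemma exists_mono {X : A} (hX : coresolvedClass 𝓠 𝓗 X) :
    ∃ (Q : A) (f : X ⟶ Q), Mono f ∧ 𝓠 Q ∧ coresolvedClass 𝓠 𝓗 (cokernel f) := by
  obtain ⟨Q, X', f, g, h, hS, hQ, hX'⟩ := hX.exists_shortExact
  exact ⟨Q, f, hS.mono_f, hQ,
    of_iso ((cokernelIsCokernel f).coconePointUniqueUpToIso hS.gIsCokernel) hX'⟩

/-- The extensions of members by members form a witnessing class: Ext^1(X₃, Q₁) = 0 permits the
horseshoe construction, and the new cokernel is again such an extension. -/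
lemma middle (hQH : 𝓠 ≤ 𝓗) (hQ : ∀ Q Q', 𝓠 Q → 𝓠 Q' → 𝓠 (Q ⊞ Q')) {S : ShortComplex A}
    (hS : S.ShortExact) (h₁ : coresolvedClass 𝓠 𝓗 S.X₁) (h₃ : coresolvedClass 𝓠 𝓗 S.X₃) :
    coresolvedClass 𝓠 𝓗 S.X₂ := by
  refine ⟨fun W => ∃ T : ShortComplex A, T.ShortExact ∧ coresolvedClass 𝓠 𝓗 T.X₁ ∧
    coresolvedClass 𝓠 𝓗 T.X₃ ∧ T.X₂ = W, ?_, ⟨S, hS, h₁, h₃, rfl⟩, ?_⟩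
  · rintro _ ⟨T, hT, h₁, h₃, rfl⟩
    exact extOrthogonal_middle hT (coresolvedClass_le _ h₁) (coresolvedClass_le _ h₃)
  · rintro _ ⟨T, hT, h₁, h₃, rfl⟩
    obtain ⟨Q₁, f₁, hf₁, hQ₁, hN₁⟩ := h₁.exists_mono
    obtain ⟨Q₃, f₃, hf₃, hQ₃, hN₃⟩ := h₃.exists_mono
    obtain ⟨h, rfl⟩ := hT.exists_extension (coresolvedClass_le _ h₃ Q₁ (hQH _ hQ₁) 0) f₁
    obtain ⟨_, a, b, w, hN⟩ := shortExact_cokernel_horseshoe hT h f₃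
    exact ⟨Q₁ ⊞ Q₃, _, biprod.lift h (T.g ≫ f₃), cokernel.π _, cokernel.condition _,
      { exact := ShortComplex.exact_cokernel _ }, hQ _ _ hQ₁ hQ₃, _, hN, hN₁, hN₃, rfl⟩

/-- For X₂ embedded in Q, the quotient Q/X₁ is an extension of Q/X₂ by X₂/X₁ ≅ X₃, so `middle`
applies to it. -/
lemma left (hQH : 𝓠 ≤ 𝓗) (hQ : ∀ Q Q', 𝓠 Q → 𝓠 Q' → 𝓠 (Q ⊞ Q')) {S : ShortComplex A}
    (hS : S.ShortExact) (h₂ : coresolvedClass 𝓠 𝓗 S.X₂) (h₃ : coresolvedClass 𝓠 𝓗 S.X₃) :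
    coresolvedClass 𝓠 𝓗 S.X₁ := by
  have := hS.mono_f
  obtain ⟨Q, f, _, hQ', hN⟩ := h₂.exists_mono
  have hY : coresolvedClass 𝓠 𝓗 (cokernel (S.f ≫ f)) :=
    middle hQH hQ (shortExact_cokernel_comp S.f f)
      (of_iso ((cokernelIsCokernel S.f).coconePointUniqueUpToIso hS.gIsCokernel) h₃) hN
  have h₁ : extOrthogonal 𝓗 S.X₁ :=
    extOrthogonal_left hS (coresolvedClass_le _ h₂) (coresolvedClass_le _ h₃)
  have hT : (ShortComplex.mk (S.f ≫ f) (cokernel.π _) (cokernel.condition _)).ShortExact :=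
    { exact := ShortComplex.exact_cokernel _ }
  exact of_shortExact hT h₁ hQ' hY

end coresolvedClass

end ExtVanishing

/-! ### Complete resolutions versus coresolved classes -/

section CompleteResolutions

/-- A bi-infinite sequence of successively related elements. -/
lemma exists_int_sequence {α : Type*} {p q : α → Prop} {r s : α → α → Prop}
    (hr : ∀ x, p x → ∃ y, p y ∧ r y x) (hs : ∀ x, q x → ∃ y, q y ∧ s x y)
    (x : α) (hp : p x) (hq : q x) :
    ∃ f : ℤ → α, f 0 = x ∧ (∀ i, 0 ≤ i → r (f (i + 1)) (f i)) ∧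
      ∀ i, i < 0 → s (f (i + 1)) (f i) := by
  choose a ha ha' using fun x : {x // p x} => hr x.1 x.2
  choose b hb hb' using fun x : {x // q x} => hs x.1 x.2
  let F : ℕ → {x // p x} := fun n => Nat.rec ⟨x, hp⟩ (fun _ y => ⟨a y, ha y⟩) n
  let G : ℕ → {x // q x} := fun n => Nat.rec ⟨x, hq⟩ (fun _ y => ⟨b y, hb y⟩) n
  refine ⟨fun i => if 0 ≤ i then (F i.toNat).1 else (G (-i).toNat).1, rfl, fun i hi => ?_,
    fun i hi => ?_⟩
  · beta_reduce
    obtain ⟨n, rfl⟩ := Int.eq_ofNat_of_zero_le hi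
    have h₁ : ((n : ℤ) + 1).toNat = n + 1 := by omega
    rw [if_pos (by omega), if_pos (by omega), h₁, Int.toNat_natCast]
    exact ha' (F n)
  · beta_reduce
    obtain ⟨n, rfl⟩ : ∃ n : ℕ, i = -(n + 1 : ℤ) := ⟨(-i - 1).toNat, by omega⟩
    have h₁ : (- -((n : ℤ) + 1)).toNat = n + 1 := by omega
    rw [if_neg (show ¬ (0 : ℤ) ≤ -(n + 1) by omega), h₁]
    have key := hb' (G n)
    -- The halves are glued at index 0: for n = 0 the element at i + 1 = 0 is taken from `F`, which
    -- starts at the same x as `G`.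
    rcases Nat.eq_zero_or_pos n with rfl | hn
    · exact key
    · rw [if_neg (by omega), show (-(-((n : ℤ) + 1) + 1)).toNat = n by omega]
      exact key

variable {A : Type w} [Category.{v} A] [Abelian A]

open Limits

/-- The class of images of `E₀ ⟶ E₋₁` in exact, `Hom(-, 𝓗)`-exact sequences `E` with `Eᵢ` in `𝓟`
for `i ≥ 0` and in `𝓠` for `i < 0`. -/
def completelyResolved (𝓟 𝓠 𝓗 : ObjectProperty A) : ObjectProperty A :=
  fun X => ∃ E : ChainComplex A ℤ, E.Acyclic ∧ IsHomExact 𝓗 E ∧ (∀ i : ℤ, 0 ≤ i → 𝓟 (E.X i)) ∧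
    (∀ i : ℤ, i < 0 → 𝓠 (E.X i)) ∧ Nonempty (X ≅ image (E.d 0 (-1)))

lemma exact_image_ι {S : ShortComplex A} (hS : S.Exact) :
    (ShortComplex.mk (image.ι S.f) S.g (image_ι_comp_eq_zero S.zero)).Exact := by
  let φ : S ⟶ ShortComplex.mk (image.ι S.f) S.g (image_ι_comp_eq_zero S.zero) :=
    { τ₁ := factorThruImage S.f, τ₂ := 𝟙 _, τ₃ := 𝟙 _ }
  have : Epi φ.τ₁ := inferInstanceAs (Epi (factorThruImage S.f))
  exact (ShortComplex.exact_iff_of_epi_of_isIso_of_mono φ).1 hS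

lemma image_ι_comp_factorThruImage_eq_zero (S : ShortComplex A) :
    image.ι S.f ≫ factorThruImage S.g = 0 := by
  rw [← cancel_mono (image.ι S.g)]
  simp [image_ι_comp_eq_zero S.zero]

lemma shortExact_image {S : ShortComplex A} (hS : S.Exact) :
    (ShortComplex.mk (image.ι S.f) (factorThruImage S.g)
      (image_ι_comp_factorThruImage_eq_zero S)).ShortExact := by
  let ψ : ShortComplex.mk (image.ι S.f) (factorThruImage S.g)
      (image_ι_comp_factorThruImage_eq_zero S) ⟶
      ShortComplex.mk (image.ι S.f) S.g (image_ι_comp_eq_zero S.zero) :=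
    { τ₁ := 𝟙 _, τ₂ := 𝟙 _, τ₃ := image.ι S.g }
  have : Mono ψ.τ₃ := inferInstanceAs (Mono (image.ι S.g))
  exact { exact := (ShortComplex.exact_iff_of_epi_of_isIso_of_mono ψ).2 (exact_image_ι hS)
          mono_f := inferInstanceAs (Mono (image.ι S.f))
          epi_g := inferInstanceAs (Epi (factorThruImage S.g)) }

lemma HomologicalComplex.Acyclic.shortExact_image {E : ChainComplex A ℤ} (hE : E.Acyclic)
    {i j k : ℤ} (hij : j + 1 = i) (hjk : k + 1 = j) :
    (ShortComplex.mk (image.ι (E.d i j)) (factorThruImage (E.d j k)) (by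
      rw [← cancel_epi (factorThruImage (E.d i j)), ← cancel_mono (image.ι (E.d j k))]
      simp)).ShortExact :=
  _root_.shortExact_image (S := E.sc' i j k)
    ((E.exactAt_iff' i j k (by simp [hij]) (by simp [← hjk])).1 (hE j))

lemma IsHomExact.exists_fac {𝓗 : ObjectProperty A} {E : ChainComplex A ℤ} (hE : IsHomExact 𝓗 E)
    {B : A} (hB : 𝓗 B) {i j k : ℤ} (hij : j + 1 = i) (hjk : k + 1 = j) (g : E.X j ⟶ B)
    (hg : E.d i j ≫ g = 0) : ∃ h : E.X k ⟶ B, E.d j k ≫ h = g := by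
  obtain rfl : k = j - 1 := by omega
  subst hij
  exact (hE B hB j g).1 hg

/-- Splicing short exact sequences `0 ⟶ Zᵢ₊₁ ⟶ Eᵢ ⟶ Zᵢ ⟶ 0`. -/
def spliceComplex {Z E : ℤ → A} {a : ∀ i, Z (i + 1) ⟶ E i} {b : ∀ i, E i ⟶ Z i}
    (w : ∀ i, a i ≫ b i = 0) : ChainComplex A ℤ :=
  ChainComplex.of E (fun i => b (i + 1) ≫ a i) (fun i => by simp [reassoc_of% w (i + 1)])

section

variable {Z E : ℤ → A} {a : ∀ i, Z (i + 1) ⟶ E i} {b : ∀ i, E i ⟶ Z i}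
  (w : ∀ i, a i ≫ b i = 0)

lemma spliceComplex_d (i : ℤ) : (spliceComplex w).d (i + 1) i = b (i + 1) ≫ a i :=
  ChainComplex.of_d _ (fun i => b (i + 1) ≫ a i) i

/-- The images of the differentials in a spliced complex. -/
noncomputable def imageSpliceIso (h : ∀ i, (ShortComplex.mk (a i) (b i) (w i)).ShortExact)
    {i j : ℤ} (hij : j + 1 = i) : Z i ≅ image ((spliceComplex w).d i j) := by
  subst hij
  let a' : Z (j + 1) ⟶ (spliceComplex w).X j := a j
  let b' : (spliceComplex w).X (j + 1) ⟶ Z (j + 1) := b (j + 1)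
  have : Mono a' := (h j).mono_f
  have : Epi b' := (h (j + 1)).epi_g
  have : StrongEpi b' := strongEpi_of_epi _
  exact image.isoStrongEpiMono b' a' (spliceComplex_d w j).symm

lemma spliceComplex_acyclic (h : ∀ i, (ShortComplex.mk (a i) (b i) (w i)).ShortExact) :
    (spliceComplex w).Acyclic := by
  intro i
  obtain ⟨k, rfl⟩ : ∃ k, i = k + 1 := ⟨i - 1, by omega⟩
  rw [HomologicalComplex.exactAt_iff' _ (k + 1 + 1) (k + 1) k (by simp) (by simp)]
  have := (h k).mono_f
  have := (h (k + 1 + 1)).epi_g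
  let S := ShortComplex.mk (b (k + 1 + 1) ≫ a (k + 1)) (b (k + 1) ≫ a k)
    (by simp [reassoc_of% w (k + 1)])
  have hS : S.Exact := by
    let T := ShortComplex.mk (a (k + 1)) (b (k + 1) ≫ a k) (by simp [reassoc_of% w (k + 1)])
    let φ : S ⟶ T := { τ₁ := b (k + 1 + 1), τ₂ := 𝟙 _, τ₃ := 𝟙 _ }
    let ψ : ShortComplex.mk (a (k + 1)) (b (k + 1)) (w (k + 1)) ⟶ T :=
      { τ₁ := 𝟙 _, τ₂ := 𝟙 _, τ₃ := a k }
    have : Epi φ.τ₁ := this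
    have : Mono ψ.τ₃ := (h k).mono_f
    rw [ShortComplex.exact_iff_of_epi_of_isIso_of_mono φ,
      ← ShortComplex.exact_iff_of_epi_of_isIso_of_mono ψ]
    exact (h (k + 1)).exact
  have e : (spliceComplex w).sc' (k + 1 + 1) (k + 1) k = S := by
    dsimp only [HomologicalComplex.sc', HomologicalComplex.shortComplexFunctor', S]
    congr 1
    · exact spliceComplex_d w (k + 1)
    · exact spliceComplex_d w k
  rw [e]
  exact hS

variable [HasExt.{u} A] {𝓗 : ObjectProperty A}

/-- A map on E (k + 1) killed by the incoming differential factors through Z (k + 1), and the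
vanishing of Ext^1 on Z k extends it to E k. -/
lemma spliceComplex_isHomExact (h : ∀ i, (ShortComplex.mk (a i) (b i) (w i)).ShortExact)
    (hZ : ∀ i H, 𝓗 H → Subsingleton (Abelian.Ext (Z i) H 1)) :
    IsHomExact 𝓗 (spliceComplex w) := by
  intro B hB i g
  constructor
  · obtain ⟨k, rfl⟩ : ∃ k, i = k + 1 := ⟨i - 1, by omega⟩
    intro hg
    have hk : k + 1 - 1 = k := by omega
    have := (h (k + 1 + 1)).epi_g
    have := (h (k + 1)).epi_g
    change (spliceComplex w).d _ _ ≫ g = 0 at hg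
    change E (k + 1) ⟶ B at g
    have hg' : a (k + 1) ≫ g = 0 := by
      rw [← cancel_epi (b (k + 1 + 1)), ← Category.assoc]
      rw [spliceComplex_d] at hg
      rw [comp_zero]
      exact hg
    obtain ⟨g', hg'⟩ : ∃ g' : Z (k + 1) ⟶ B, b (k + 1) ≫ g' = g :=
      ⟨(h (k + 1)).exact.desc g hg', (h (k + 1)).exact.g_desc g hg'⟩
    obtain ⟨g₂, hg₂⟩ := (h k).exists_extension (hZ k B hB) g'
    change a k ≫ g₂ = g' at hg₂
    -- The index k + 1 - 1 equals k only propositionally, so it is generalized before substitution.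
    suffices ∀ j, j = k → ∃ y, (spliceComplex w).d (k + 1) j ≫ y = g from this _ hk
    rintro j rfl
    refine ⟨g₂, ?_⟩
    rw [spliceComplex_d, ← hg', ← hg₂]
    exact Category.assoc _ _ _
  · rintro ⟨y, rfl⟩
    simp

end

variable [HasExt.{u} A] {𝓟 𝓠 𝓗 : ObjectProperty A}

/-- Dimension shifting along 0 ⟶ im d_{i+1} ⟶ E_i ⟶ im d_i ⟶ 0, for all images at once.
Hom-exactness is what extends maps from im d_{i+1} to E_i, which settles degree one. -/
lemma extOrthogonal_image {E : ChainComplex A ℤ} (hE : E.Acyclic) (hH : IsHomExact 𝓗 E)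
    (hX : ∀ i, extOrthogonal 𝓗 (E.X i)) {i j : ℤ} (hij : j + 1 = i) :
    extOrthogonal 𝓗 (image (E.d i j)) := by
  intro H h𝓗 n
  induction n generalizing i j with
  | zero =>
    refine (hE.shortExact_image (i := i + 1) rfl hij).subsingleton_ext_one_right ?_ (hX i H h𝓗 0)
    intro (f : image (E.d (i + 1) i) ⟶ H)
    obtain ⟨h, hh⟩ := hH.exists_fac h𝓗 (i := i + 1 + 1) (k := i) rfl rfl
      (factorThruImage (E.d (i + 1) i) ≫ f) (by
        rw [← Category.assoc]
        convert zero_comp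
        rw [← cancel_mono (image.ι _)]
        simp)
    refine ⟨h, ?_⟩
    change image.ι (E.d (i + 1) i) ≫ h = f
    rw [← cancel_epi (factorThruImage (E.d (i + 1) i)), ← hh, image.fac_assoc]
  | succ n ih =>
    exact (hE.shortExact_image (i := i + 1) rfl hij).subsingleton_ext_right (ih rfl)
      (hX i H h𝓗 (n + 1))

/-- The images of the differentials landing in negative degrees form a witnessing class: each embeds
in a term from 𝓠 with the next image as cokernel. -/
lemma completelyResolved.coresolvedClass (hP : 𝓟 ≤ extOrthogonal 𝓗) (hQ : 𝓠 ≤ extOrthogonal 𝓗)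
    {X : A} (hX : completelyResolved 𝓟 𝓠 𝓗 X) : coresolvedClass 𝓠 𝓗 X := by
  obtain ⟨E, hE, hH, hEP, hEQ, ⟨e⟩⟩ := hX
  have hE' (i : ℤ) : extOrthogonal 𝓗 (E.X i) := by
    by_cases hi : 0 ≤ i
    · exact hP _ (hEP i hi)
    · exact hQ _ (hEQ i (by omega))
  refine .of_iso e ⟨fun W => ∃ i j : ℤ, j + 1 = i ∧ j < 0 ∧ image (E.d i j) = W, ?_,
    ⟨0, -1, rfl, by omega, rfl⟩, ?_⟩
  · rintro _ ⟨i, j, hij, -, rfl⟩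
    exact extOrthogonal_image hE hH hE' hij
  · rintro _ ⟨i, j, hij, hj, rfl⟩
    exact ⟨_, _, _, _, _, hE.shortExact_image hij (k := j - 1) (by omega), hEQ j hj,
      j, j - 1, by omega, by omega, rfl⟩

/-- Splices a projective resolution to a coresolution. Syzygies of orthogonal objects are
orthogonal, so every object along which the sequence is spliced is orthogonal to 𝓗, which gives
Hom-exactness. -/
lemma coresolvedClass.completelyResolved [EnoughProjectives A] (hP : ∀ P, Projective P → 𝓟 P)
    {X : A} (hX : coresolvedClass 𝓠 𝓗 X) : completelyResolved 𝓟 𝓠 𝓗 X := by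
  let r (𝓔 : ObjectProperty A) (Y Z : A) : Prop := extOrthogonal 𝓗 Z ∧
    ∃ (E : A) (a : Y ⟶ E) (b : E ⟶ Z) (w : a ≫ b = 0),
      (ShortComplex.mk a b w).ShortExact ∧ 𝓔 E
  obtain ⟨Z, hZ₀, hZP, hZQ⟩ := exists_int_sequence (p := extOrthogonal 𝓗)
    (q := _root_.coresolvedClass 𝓠 𝓗) (r := r 𝓟)
    (s := fun Y Z => extOrthogonal 𝓗 Z ∧ r 𝓠 Y Z)
    (fun Z hZ => by
      have hS : (ShortComplex.mk _ _ (kernel.condition (Projective.π Z))).ShortExact :=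
        { exact := ShortComplex.exact_kernel _ }
      exact ⟨_, extOrthogonal_left hS (extOrthogonal_of_projective _) hZ, hZ, _, _, _, _, hS,
        hP _ inferInstance⟩)
    (fun Y hY => by
      obtain ⟨Q, Z, a, b, w, hS, hQ, hZ⟩ := hY.exists_shortExact
      have := coresolvedClass_le _ hZ
      exact ⟨Z, hZ, this, this, Q, a, b, w, hS, hQ⟩)
    X (coresolvedClass_le _ hX) hX
  have hZ (i : ℤ) : extOrthogonal 𝓗 (Z i) := by
    by_cases hi : 0 ≤ i
    · exact (hZP i hi).1
    · exact (hZQ i (by omega)).1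
  have key (i : ℤ) : ∃ (E : A) (a : Z (i + 1) ⟶ E) (b : E ⟶ Z i) (w : a ≫ b = 0),
      (ShortComplex.mk a b w).ShortExact ∧ (0 ≤ i → 𝓟 E) ∧ (i < 0 → 𝓠 E) := by
    by_cases hi : 0 ≤ i
    · obtain ⟨E, a, b, w, hS, hE⟩ := (hZP i hi).2
      exact ⟨E, a, b, w, hS, fun _ => hE, fun _ => by omega⟩
    · obtain ⟨E, a, b, w, hS, hE⟩ := (hZQ i (by omega)).2.2
      exact ⟨E, a, b, w, hS, fun _ => by omega, fun _ => hE⟩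
  choose E a b w hS hEP hEQ using key
  subst hZ₀
  refine ⟨spliceComplex w, spliceComplex_acyclic w hS,
    spliceComplex_isHomExact w hS fun i H hH => hZ i H hH 0, hEP, hEQ, ⟨?_⟩⟩
  exact (imageSpliceIso w hS (show (-1 : ℤ) + 1 = 0 by norm_num))

end CompleteResolutions

/-! ### Sums of disks -/

section DiskSums

open Limits Abelian

variable {A : Type w} [Category.{v} A] [Abelian A]

/-- The contractible complex with `Mᵢ ⊞ Mᵢ₊₁` in degree `i`: the sum of the disks on the `Mᵢ`. -/
noncomputable def diskSum (M : ℤ → A) : ChainComplex A ℤ :=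
  spliceComplex (Z := M) (E := fun i => M i ⊞ M (i + 1)) (a := fun _ => biprod.inr)
    (b := fun _ => biprod.fst) (fun _ => biprod.inr_fst)

namespace diskSum

variable (M : ℤ → A)

/-- The inclusion of the degree `i` part of the generators. -/
noncomputable def ι (i : ℤ) : M i ⟶ (diskSum M).X i := (biprod.inl : M i ⟶ M i ⊞ M (i + 1))

/-- The inclusion of the degree `i` part of the boundaries. -/
noncomputable def κ (i : ℤ) : M (i + 1) ⟶ (diskSum M).X i :=
  (biprod.inr : M (i + 1) ⟶ M i ⊞ M (i + 1))

/-- The projection to the degree `i` part of the generators. -/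
noncomputable def π (i : ℤ) : (diskSum M).X i ⟶ M i := (biprod.fst : M i ⊞ M (i + 1) ⟶ M i)

@[simp]
lemma ι_π (i : ℤ) : ι M i ≫ π M i = 𝟙 _ :=
  biprod.inl_fst (X := M i) (Y := M (i + 1))

@[simp]
lemma ι_π_assoc (i : ℤ) {Y : A} (f : M i ⟶ Y) : ι M i ≫ π M i ≫ f = f := by
  rw [← Category.assoc, ι_π, Category.id_comp]

@[simp]
lemma κ_π (i : ℤ) : κ M i ≫ π M i = 0 :=
  biprod.inr_fst (X := M i) (Y := M (i + 1))

@[simp]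
lemma κ_π_assoc (i : ℤ) {Y : A} (f : M i ⟶ Y) : κ M i ≫ π M i ≫ f = 0 := by
  rw [← Category.assoc, κ_π, zero_comp]

lemma shortExact (i : ℤ) : (ShortComplex.mk (κ M i) (π M i) (κ_π M i)).ShortExact :=
  (ShortComplex.Splitting.mk (S := ShortComplex.mk (biprod.inr : M (i + 1) ⟶ M i ⊞ M (i + 1))
    biprod.fst (biprod.inr_fst (X := M i))) biprod.snd biprod.inl (by simp) (by simp)
    ((add_comm _ _).trans (biprod.total (X := M i) (Y := M (i + 1))))).shortExact

lemma acyclic : (diskSum M).Acyclic := spliceComplex_acyclic _ (shortExact M)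

lemma d_eq (i : ℤ) : (diskSum M).d (i + 1) i = π M (i + 1) ≫ κ M i := spliceComplex_d _ i

lemma ι_d (i : ℤ) : ι M (i + 1) ≫ (diskSum M).d (i + 1) i = κ M i := by
  simp [d_eq]

variable {M} {N : ℤ → A} {X : ChainComplex A ℤ}

lemma X_hom_ext {i : ℤ} {Y : A} {f g : (diskSum M).X i ⟶ Y} (h₁ : ι M i ≫ f = ι M i ≫ g)
    (h₂ : κ M i ≫ f = κ M i ≫ g) : f = g :=
  biprod.hom_ext' (X := M i) (Y := M (i + 1)) _ _ h₁ h₂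

/-- Morphisms out of a term of a sum of disks. -/
noncomputable def XDesc {i : ℤ} {Y : A} (f : M i ⟶ Y) (g : M (i + 1) ⟶ Y) :
    (diskSum M).X i ⟶ Y :=
  biprod.desc (X := M i) (Y := M (i + 1)) f g

@[simp]
lemma ι_XDesc {i : ℤ} {Y : A} (f : M i ⟶ Y) (g : M (i + 1) ⟶ Y) : ι M i ≫ XDesc f g = f :=
  biprod.inl_desc (X := M i) (Y := M (i + 1)) _ _

@[simp]
lemma ι_XDesc_assoc {i : ℤ} {Y Z : A} (f : M i ⟶ Y) (g : M (i + 1) ⟶ Y) (h : Y ⟶ Z) :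
    ι M i ≫ XDesc f g ≫ h = f ≫ h := by
  rw [← Category.assoc, ι_XDesc]

@[simp]
lemma κ_XDesc {i : ℤ} {Y : A} (f : M i ⟶ Y) (g : M (i + 1) ⟶ Y) : κ M i ≫ XDesc f g = g :=
  biprod.inr_desc (X := M i) (Y := M (i + 1)) _ _

@[simp]
lemma κ_XDesc_assoc {i : ℤ} {Y Z : A} (f : M i ⟶ Y) (g : M (i + 1) ⟶ Y) (h : Y ⟶ Z) :
    κ M i ≫ XDesc f g ≫ h = g ≫ h := by
  rw [← Category.assoc, κ_XDesc]

lemma hom_ext {φ ψ : diskSum M ⟶ X} (h : ∀ i, ι M i ≫ φ.f i = ι M i ≫ ψ.f i) : φ = ψ := by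
  ext i
  refine X_hom_ext (h i) ?_
  have := h (i + 1) =≫ X.d (i + 1) i
  simpa [← ι_d] using this

/-- Morphisms out of a sum of disks are given by their components on the generators. -/
noncomputable def desc (g : ∀ i, M i ⟶ X.X i) : diskSum M ⟶ X where
  f i := XDesc (g i) (g (i + 1) ≫ X.d (i + 1) i)
  comm' i j hij := by
    obtain rfl : j + 1 = i := hij
    refine X_hom_ext ?_ ?_ <;> simp [d_eq]

@[simp]
lemma ι_desc (g : ∀ i, M i ⟶ X.X i) (i : ℤ) : ι M i ≫ (desc g).f i = g i :=
  ι_XDesc _ _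

@[simp]
lemma ι_desc_assoc (g : ∀ i, M i ⟶ X.X i) (i : ℤ) {Y : A} (h : X.X i ⟶ Y) :
    ι M i ≫ (desc g).f i ≫ h = g i ≫ h := by
  rw [← Category.assoc, ι_desc]

@[simp]
lemma κ_desc (g : ∀ i, M i ⟶ X.X i) (i : ℤ) :
    κ M i ≫ (desc g).f i = g (i + 1) ≫ X.d (i + 1) i :=
  κ_XDesc _ _

@[simp]
lemma κ_desc_assoc (g : ∀ i, M i ⟶ X.X i) (i : ℤ) {Y : A} (h : X.X i ⟶ Y) :
    κ M i ≫ (desc g).f i ≫ h = g (i + 1) ≫ X.d (i + 1) i ≫ h := by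
  rw [← Category.assoc, κ_desc, Category.assoc]

/-- The functoriality of sums of disks. -/
noncomputable def map (g : ∀ i, M i ⟶ N i) : diskSum M ⟶ diskSum N :=
  desc fun i => g i ≫ ι N i

@[simp]
lemma ι_map (g : ∀ i, M i ⟶ N i) (i : ℤ) : ι M i ≫ (map g).f i = g i ≫ ι N i :=
  ι_desc _ _

@[simp]
lemma ι_map_assoc (g : ∀ i, M i ⟶ N i) (i : ℤ) {Y : A} (h : (diskSum N).X i ⟶ Y) :
    ι M i ≫ (map g).f i ≫ h = g i ≫ ι N i ≫ h := by
  rw [← Category.assoc, ι_map, Category.assoc]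

lemma map_f (g : ∀ i, M i ⟶ N i) (i : ℤ) : (map g).f i = biprod.map (g i) (g (i + 1)) := by
  refine X_hom_ext ?_ ?_
  · rw [ι_map]
    exact (biprod.inl_map _ _).symm
  · rw [map, κ_desc, Category.assoc, ι_d]
    exact (biprod.inr_map _ _).symm

lemma shortExact_biprod_map {S T : ShortComplex A} (hS : S.ShortExact) (hT : T.ShortExact) :
    (ShortComplex.mk (biprod.map S.f T.f) (biprod.map S.g T.g) (by ext <;> simp)).ShortExact := by
  have := hS.mono_f
  have := hS.epi_g
  have := hT.mono_f
  have := hT.epi_g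
  have h₁ : Mono (biprod.map S.f T.f) := inferInstance
  have h₂ : Epi (biprod.map S.g T.g) := inferInstance
  refine { exact := ShortComplex.exact_of_f_is_kernel _ (KernelFork.IsLimit.ofι _ _
    (fun k hk => biprod.lift
      (hS.exact.lift (k ≫ biprod.fst) (by simpa using hk =≫ biprod.fst))
      (hT.exact.lift (k ≫ biprod.snd) (by simpa using hk =≫ biprod.snd))) (fun k hk => ?_)
      (fun k hk m hm => ?_)) }
  · ext <;> simp
  · rw [← cancel_mono (biprod.map S.f T.f)]
    erw [hm]
    ext <;> simp

lemma shortExact_map {S : ℤ → ShortComplex A} (hS : ∀ i, (S i).ShortExact) :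
    (ShortComplex.mk (map fun i => (S i).f) (map fun i => (S i).g)
      (hom_ext fun i => by simp)).ShortExact := by
  refine HomologicalComplex.shortExact_of_degreewise_shortExact _ fun i => ?_
  convert shortExact_biprod_map (hS i) (hS (i + 1)) using 1
  dsimp only [ShortComplex.map, HomologicalComplex.eval]
  congr 1
  · exact map_f _ i
  · exact map_f _ i

instance projective [∀ i, Projective (M i)] : Projective (diskSum M) where
  factors {E X} f e _ := by
    have (i : ℤ) : Epi (e.f i) := inferInstance
    refine ⟨desc fun i => Projective.factorThru (ι M i ≫ f.f i) (e.f i), hom_ext fun i => ?_⟩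
    simp

/-- A complex is covered by the sum of disks on covers of its terms. -/
lemma epi_desc (g : ∀ i, M i ⟶ X.X i) [∀ i, Epi (g i)] : Epi (desc g) := by
  have (i : ℤ) : Epi ((desc g).f i) := epi_of_epi_fac (ι_desc g i)
  exact HomologicalComplex.epi_of_epi_f _ this

end diskSum

instance ChainComplex.enoughProjectives [EnoughProjectives A] :
    EnoughProjectives (ChainComplex A ℤ) where
  presentation X := ⟨
    { p := diskSum fun i => Projective.over (X.X i)
      f := diskSum.desc fun i => Projective.π (X.X i)
      epi := diskSum.epi_desc _ }⟩

namespace HomologicalComplex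

variable {X : ChainComplex A ℤ}

lemma fromOpcycles_pOpcycles (i : ℤ) : X.fromOpcycles (i + 1) i ≫ X.pOpcycles i = 0 := by
  rw [← cancel_epi (X.pOpcycles (i + 1))]
  simp

lemma Acyclic.shortExact_opcycles (hX : X.Acyclic) (i : ℤ) :
    (ShortComplex.mk (X.fromOpcycles (i + 1) i) (X.pOpcycles i)
      (fromOpcycles_pOpcycles i)).ShortExact := by
  let φ : ShortComplex.mk (X.d (i + 1) i) (X.pOpcycles i) (X.d_pOpcycles _ _) ⟶
      ShortComplex.mk (X.fromOpcycles (i + 1) i) (X.pOpcycles i) (fromOpcycles_pOpcycles i) :=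
    { τ₁ := X.pOpcycles (i + 1), τ₂ := 𝟙 _, τ₃ := 𝟙 _ }
  have : Epi φ.τ₁ := inferInstanceAs (Epi (X.pOpcycles (i + 1)))
  exact
    { exact := (ShortComplex.exact_iff_of_epi_of_isIso_of_mono φ).1
        (ShortComplex.exact_of_g_is_cokernel _ (X.opcyclesIsCokernel (i + 1) i (by simp)))
      mono_f := Preadditive.mono_of_isZero_kernel' _ (X.homologyIsKernel (i + 1) i (by simp))
        (hX (i + 1)).isZero_homology
      epi_g := inferInstanceAs (Epi (X.pOpcycles i)) }

/-- In an acyclic complex, the cycles are the opcycles of the next degree. -/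
noncomputable def Acyclic.cyclesIso (hX : X.Acyclic) (i : ℤ) :
    X.cycles i ≅ X.opcycles (i + 1) := by
  have hij : i - 1 + 1 = i := by omega
  have : Mono (X.fromOpcycles i (i - 1)) := by
    have := (hX.shortExact_opcycles (i - 1)).mono_f
    dsimp only at this
    rwa [hij] at this
  exact (X.cyclesIsKernel i (i - 1) (by simp)).conePointUniqueUpToIso
    (isKernelCompMono (hX.shortExact_opcycles i).fIsKernel (X.fromOpcycles i (i - 1))
      (X.p_fromOpcycles i (i - 1)).symm)

/-- An acyclic complex whose short exact sequences of cycles split is a sum of disks. -/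
lemma Acyclic.nonempty_iso_diskSum (hX : X.Acyclic)
    (h : ∀ i, IsSplitEpi (X.pOpcycles i)) : Nonempty (X ≅ diskSum fun i => X.opcycles i) := by
  let φ : diskSum (fun i => X.opcycles i) ⟶ X := diskSum.desc fun i => section_ (X.pOpcycles i)
  have hφ (i : ℤ) : IsIso (φ.f i) := by
    -- In each degree, φ is an isomorphism by the five lemma: it compares two short exact sequences
    -- with the same outer terms.
    let ψ : ShortComplex.mk _ _ (diskSum.κ_π (A := A) (fun i => X.opcycles i) i) ⟶
        ShortComplex.mk (X.fromOpcycles (i + 1) i) (X.pOpcycles i) (fromOpcycles_pOpcycles i) :=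
      { τ₁ := 𝟙 _
        τ₂ := φ.f i
        τ₃ := 𝟙 _
        comm₁₂ := by
          simp only [φ, diskSum.κ_desc, ← X.p_fromOpcycles, IsSplitEpi.id_assoc, Category.id_comp]
        comm₂₃ := by
          refine diskSum.X_hom_ext (M := fun i => X.opcycles i) ?_ ?_
          · simp [φ]
          · simp [φ] }
    exact ShortComplex.isIso₂_of_shortExact_of_isIso₁₃' ψ (diskSum.shortExact _ i)
      (hX.shortExact_opcycles i) (inferInstanceAs (IsIso (𝟙 _))) (inferInstanceAs (IsIso (𝟙 _)))
  have : IsIso φ := HomologicalComplex.Hom.isIso_of_components φ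
  exact ⟨(asIso φ).symm⟩

end HomologicalComplex

namespace diskSum

/-- The opcycles of a sum of disks. -/
noncomputable def opcyclesIso (M : ℤ → A) (i : ℤ) : (diskSum M).opcycles i ≅ M i :=
  have : Epi (π M (i + 1)) := (shortExact M (i + 1)).epi_g
  ((diskSum M).opcyclesIsCokernel (i + 1) i (by simp)).coconePointUniqueUpToIso
    (isCokernelEpiComp (shortExact M i).gIsCokernel (π M (i + 1)) (d_eq M i))

/-- The cycles of a sum of disks. -/
noncomputable def cyclesIso (M : ℤ → A) (i : ℤ) : (diskSum M).cycles i ≅ M (i + 1) :=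
  (acyclic M).cyclesIso i ≪≫ opcyclesIso M (i + 1)

variable {X : ChainComplex A ℤ}

variable [EnoughProjectives A] [HasExt.{u} A] [HasExt.{u} (ChainComplex A ℤ)]

/-- Maps from the sum of disks to X are arbitrary families M i ⟶ X.X i. Projective presentations of
the M i induce one of the sum of disks whose syzygy is again a sum of disks, so dimension shifting
proceeds degreewise. -/
lemma subsingleton_ext {M : ℤ → A}
    (h : ∀ i n, Subsingleton (Ext (M i) (X.X i) (n + 1))) (n : ℕ) :
    Subsingleton (Ext (diskSum M) X (n + 1)) := by
  induction n generalizing M with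
  | zero =>
    have hS (i : ℤ) : (ShortComplex.mk _ _ (kernel.condition (Projective.π (M i)))).ShortExact :=
      { exact := ShortComplex.exact_kernel _ }
    refine (diskSum.shortExact_map hS).subsingleton_ext_one_right (fun f => ?_)
      (Ext.subsingleton_of_projective _ _ _)
    choose g hg using fun i => (hS i).exists_extension (h i 0)
      (ι (fun i => kernel (Projective.π (M i))) i ≫ f.f i)
    refine ⟨desc g, hom_ext fun i => ?_⟩
    simpa using hg i
  | succ n ih =>
    have hS (i : ℤ) : (ShortComplex.mk _ _ (kernel.condition (Projective.π (M i)))).ShortExact :=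
      { exact := ShortComplex.exact_kernel _ }
    exact (diskSum.shortExact_map hS).subsingleton_ext_right (ih fun i n =>
      (hS i).subsingleton_ext_left (Ext.subsingleton_of_projective _ _ _) (h i _))
      (Ext.subsingleton_of_projective _ _ _)

end diskSum

end DiskSums

/-! ### Tensor-Hom comparison maps -/

section TensorHom

open LinearMap TensorProduct

variable {R : Type u} [CommRing R] {K K' Q N F P X Y H C : Type*}
  [AddCommGroup K] [Module R K] [AddCommGroup K'] [Module R K'] [AddCommGroup Q] [Module R Q]
  [AddCommGroup N] [Module R N] [AddCommGroup F] [Module R F] [AddCommGroup P] [Module R P]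
  [AddCommGroup X] [Module R X] [AddCommGroup Y] [Module R Y] [AddCommGroup H] [Module R H]
  [AddCommGroup C] [Module R C]

/-- Precomposition is compatible with `Hom(M, N) ⊗ F ⟶ Hom(M, N ⊗ F)`. -/
lemma rTensorHomToHomRTensor_lcomp (p : Q →ₗ[R] K) (x : (K →ₗ[R] N) ⊗[R] F) :
    rTensorHomToHomRTensor (.id R) Q N F ((lcomp R N p).rTensor F x) =
      rTensorHomToHomRTensor (.id R) K N F x ∘ₗ p := by
  induction x with
  | zero => simp
  | tmul f y => ext q; simp
  | add x y hx hy => simp only [map_add, hx, hy, add_comp]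

lemma lcomp_injective {p : Q →ₗ[R] K} (hp : Function.Surjective p) :
    Function.Injective (lcomp R N p) :=
  fun _ _ h => LinearMap.ext fun k => by
    obtain ⟨q, rfl⟩ := hp k
    exact LinearMap.congr_fun h q

lemma lcomp_exact {i : K' →ₗ[R] Q} {p : Q →ₗ[R] K} (hip : Function.Exact i p)
    (hp : Function.Surjective p) : Function.Exact (lcomp R N p) (lcomp R N i) := by
  intro f
  constructor
  · intro hf
    have hle : ker p ≤ ker f := by
      intro q hq
      obtain ⟨k, rfl⟩ := (hip q).1 hq
      exact LinearMap.congr_fun hf k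
    refine ⟨(ker p).liftQ f hle ∘ₗ (p.quotKerEquivOfSurjective hp).symm, ?_⟩
    ext q
    have : (p.quotKerEquivOfSurjective hp).symm (p q) = (ker p).mkQ q := by
      rw [LinearEquiv.symm_apply_eq]
      rfl
    simp [this]
  · rintro ⟨g, rfl⟩
    ext k
    simp [hip.apply_apply_eq_zero]

/-- By flatness of F, a finite free cover of K embeds the source into the one for the free module,
where the comparison is an isomorphism. -/
lemma rTensorHomToHomRTensor_injective [Module.Finite R K] [Module.Flat R F] :
    Function.Injective (rTensorHomToHomRTensor (.id R) K N F) := by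
  obtain ⟨n, p, hp⟩ := Module.Finite.exists_fin' R K
  have h₁ : Function.Injective (rTensorHomToHomRTensor (.id R) (Fin n → R) N F) := by
    rw [← rTensorHomEquivHomRTensor_toLinearMap]
    exact (rTensorHomEquivHomRTensor R (Fin n → R) N F).injective
  refine (injective_iff_map_eq_zero _).2 fun x hx => ?_
  have h₂ := Module.Flat.rTensor_preserves_injective_linearMap (M := F) _
    (lcomp_injective (N := N) hp)
  refine (injective_iff_map_eq_zero _).1 h₂ x ((injective_iff_map_eq_zero _).1 h₁ _ ?_)
  rw [rTensorHomToHomRTensor_lcomp, hx, zero_comp]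

/-- The kernel of a finite free cover is finite, so injectivity there shows that a preimage found
over the free module descends to K. -/
lemma rTensorHomToHomRTensor_surjective [Module.FinitePresentation R K] [Module.Flat R F] :
    Function.Surjective (rTensorHomToHomRTensor (.id R) K N F) := by
  obtain ⟨n, p, hp⟩ := Module.Finite.exists_fin' R K
  intro g
  have hfin : Module.Finite R (ker p) :=
    Module.Finite.iff_fg.2 (Module.FinitePresentation.fg_ker p hp)
  obtain ⟨x, hx⟩ := (rTensorHomEquivHomRTensor R (Fin n → R) N F).surjective (g ∘ₗ p)
  rw [rTensorHomEquivHomRTensor_apply] at hx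
  have hip : Function.Exact (ker p).subtype p := p.exact_subtype_ker_map
  have hx' : (lcomp R N (ker p).subtype).rTensor F x = 0 := by
    refine (injective_iff_map_eq_zero _).1 rTensorHomToHomRTensor_injective _ ?_
    rw [rTensorHomToHomRTensor_lcomp, hx, comp_assoc, hip.linearMap_comp_eq_zero, comp_zero]
  obtain ⟨y, rfl⟩ := (Module.Flat.rTensor_exact F (lcomp_exact (N := N) hip hp) x).1 hx'
  refine ⟨y, lcomp_injective hp ?_⟩
  rw [rTensorHomToHomRTensor_lcomp] at hx
  exact hx

variable (R K F C) in
/-- The evaluation map `K ⊗ F ⟶ Hom(Hom(K, C), C ⊗ F)`. -/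
noncomputable def tensorBidual : K ⊗[R] F →ₗ[R] (K →ₗ[R] C) →ₗ[R] C ⊗[R] F :=
  (rTensorHom F).flip

@[simp]
lemma tensorBidual_apply (x : K ⊗[R] F) (φ : K →ₗ[R] C) :
    tensorBidual R K F C x φ = φ.rTensor F x := rfl

/-- Every endomorphism of C is a scalar, so a map out of Hom(C, C) is determined by its value at the
identity, which may be any element of C ⊗ F. -/
lemma tensorBidual_self_bijective (hC : Function.Bijective (lsmul R C)) :
    Function.Bijective (tensorBidual R C F C) := by
  constructor
  · refine (injective_iff_map_eq_zero _).2 fun x hx => ?_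
    simpa using LinearMap.congr_fun hx LinearMap.id
  · intro ψ
    refine ⟨ψ LinearMap.id, LinearMap.ext fun φ => ?_⟩
    obtain ⟨r, rfl⟩ := hC.2 φ
    have h : lsmul R C r = r • LinearMap.id := by ext; simp
    rw [h, map_smul, map_smul]
    simp

/-- For `C` semidualizing and `F` flat, `F ⟶ Hom(C, C ⊗ F)` is an isomorphism. -/
lemma mk_flip_bijective [Module.FinitePresentation R C] [Module.Flat R F]
    (hC : Function.Bijective (lsmul R C)) : Function.Bijective (TensorProduct.mk R C F).flip := by
  let e : F ≃ₗ[R] (C →ₗ[R] C) ⊗[R] F := (TensorProduct.lid R F).symm ≪≫ₗ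
    TensorProduct.congr (LinearEquiv.ofBijective (lsmul R C : R →ₗ[R] C →ₗ[R] C) hC) (.refl R F)
  have h : (TensorProduct.mk R C F).flip =
      rTensorHomToHomRTensor (.id R) C C F ∘ₗ e.toLinearMap := by
    ext f c
    simp [e]
  rw [h]
  exact (show Function.Bijective (rTensorHomToHomRTensor (.id R) C C F) from
    ⟨rTensorHomToHomRTensor_injective, rTensorHomToHomRTensor_surjective⟩).comp e.bijective

lemma exists_finite_dual_basis [Module.Finite R Q] [Module.Projective R Q] :
    ∃ (n : ℕ) (e : Fin n → Q) (s : Fin n → Q →ₗ[R] R),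
      ∀ q, ∑ i, s i q • e i = q := by
  obtain ⟨n, f, g, -, -, hfg⟩ := Module.Finite.exists_comp_eq_id_of_projective R Q
  refine ⟨n, fun i => f (Pi.single i 1), fun i => proj i ∘ₗ g, fun q => ?_⟩
  conv_rhs => rw [← LinearMap.id_apply (R := R) q, ← hfg, LinearMap.comp_apply,
    ← LinearMap.sum_single_apply (fun _ : Fin n => R) (g q)]
  rw [map_sum]
  refine Finset.sum_congr rfl fun i _ => ?_
  rw [LinearMap.comp_apply, proj_apply, ← map_smul, ← Pi.single_smul]
  simp

/-- A finite dual basis reduces the claim to Q = R, where the map is F ⟶ Hom(C, C ⊗ F), bijective by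
`mk_flip_bijective`. -/
lemma tensorBidual_bijective_of_projective [Module.Finite R Q] [Module.Projective R Q]
    [Module.FinitePresentation R C] [Module.Flat R F] (hC : Function.Bijective (lsmul R C)) :
    Function.Bijective (tensorBidual R Q F C) := by
  obtain ⟨n, e, s, hes⟩ := exists_finite_dual_basis (R := R) (Q := Q)
  constructor
  · refine (injective_iff_map_eq_zero _).2 fun x hx => ?_
    have hs (i : Fin n) : (s i).rTensor F x = 0 := by
      rw [← (TensorProduct.lid R F).map_eq_zero_iff]
      refine (injective_iff_map_eq_zero _).1 (mk_flip_bijective (F := F) hC).1 _ ?_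
      ext c
      have := LinearMap.congr_fun hx (toSpanSingleton R C c ∘ₗ s i)
      rw [tensorBidual_apply, rTensor_comp, LinearMap.comp_apply] at this
      generalize (s i).rTensor F x = y at this
      have h (y : R ⊗[R] F) : (toSpanSingleton R C c).rTensor F y =
          c ⊗ₜ[R] (TensorProduct.lid R F y) := by
        induction y with
        | zero => simp
        | tmul r f => simp [smul_tmul]
        | add a b ha hb => simp only [map_add, ha, hb, tmul_add]
      rw [h] at this
      simpa using this
    have hid : (LinearMap.id : Q →ₗ[R] Q) = ∑ i, toSpanSingleton R Q (e i) ∘ₗ s i := by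
      ext q
      simp [hes]
    have : x = (LinearMap.id : Q →ₗ[R] Q).rTensor F x := by simp
    rw [this, hid, ← coe_rTensorHom, map_sum, LinearMap.sum_apply]
    refine Finset.sum_eq_zero fun i _ => ?_
    rw [coe_rTensorHom, rTensor_comp, LinearMap.comp_apply, hs, map_zero]
  · intro ψ
    choose f hf using fun i => (mk_flip_bijective (F := F) hC).2
      (ψ ∘ₗ (smulRightₗ (R := R) (M₂ := Q) (M := C)  (s i)))
    refine ⟨∑ i, e i ⊗ₜ f i, LinearMap.ext fun φ => ?_⟩
    have hφ : φ = ∑ i, smulRight (s i) (φ (e i)) := by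
      ext q
      conv_lhs => rw [← hes q]
      simp
    conv_rhs => rw [hφ, map_sum]
    rw [map_sum, LinearMap.sum_apply]
    refine Finset.sum_congr rfl fun i _ => ?_
    exact LinearMap.congr_fun (hf i) (φ (e i))

section

variable {i : K' →ₗ[R] Q} {p : Q →ₗ[R] K}

/-- For surjectivity, ψ pulled back to Hom(Q, C) is evaluation at some y in Q ⊗ F. Injectivity for K
kills the image of y in K ⊗ F, so y comes from K' ⊗ F, and surjectivity of Hom(Q, C) ⟶ Hom(K', C)
recovers ψ. -/
lemma tensorBidual_bijective_of_exact [Module.Flat R F] (hi : Function.Injective i)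
    (hip : Function.Exact i p) (hp : Function.Surjective p)
    (hC : Function.Surjective (lcomp R C i)) (hK : Function.Injective (tensorBidual R K F C))
    (hQ : Function.Bijective (tensorBidual R Q F C)) :
    Function.Bijective (tensorBidual R K' F C) := by
  constructor
  · refine (injective_iff_map_eq_zero _).2 fun x hx => ?_
    refine (injective_iff_map_eq_zero _).1
      (Module.Flat.rTensor_preserves_injective_linearMap (M := F) i hi) _
      ((injective_iff_map_eq_zero _).1 hQ.1 _ ?_)
    ext φ
    rw [tensorBidual_apply, ← LinearMap.comp_apply, ← rTensor_comp]
    exact LinearMap.congr_fun hx (φ ∘ₗ i)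
  · intro ψ
    obtain ⟨y, hy⟩ := hQ.2 (ψ ∘ₗ lcomp R C i)
    have hy' (φ : Q →ₗ[R] C) : φ.rTensor F y = ψ (φ ∘ₗ i) := LinearMap.congr_fun hy φ
    have hpy : p.rTensor F y = 0 := by
      refine (injective_iff_map_eq_zero _).1 hK _ (LinearMap.ext fun φ => ?_)
      rw [tensorBidual_apply, ← LinearMap.comp_apply, ← rTensor_comp, hy', comp_assoc,
        hip.linearMap_comp_eq_zero, comp_zero, map_zero, LinearMap.zero_apply]
    obtain ⟨x, rfl⟩ := (rTensor_exact F hip hp y).1 hpy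
    refine ⟨x, LinearMap.ext fun φ => ?_⟩
    obtain ⟨φ, rfl⟩ := hC φ
    rw [tensorBidual_apply, lcomp_apply', rTensor_comp,
    LinearMap.comp_apply]
    exact hy' φ

/-- Maps `Hom(K, C) ⟶ C ⊗ F` extend along `Hom(K, C) ⟶ Hom(Q, C)`. -/
lemma exists_extension_lcomp (hp : Function.Surjective p)
    (hK : Function.Surjective (tensorBidual R K F C)) (g : (K →ₗ[R] C) →ₗ[R] C ⊗[R] F) :
    ∃ g' : (Q →ₗ[R] C) →ₗ[R] C ⊗[R] F, g' ∘ₗ lcomp R C p = g := by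
  -- The map is evaluation at an element of K ⊗ F; a lift of that element to Q ⊗ F evaluates on all
  -- of Hom(Q, C).
  obtain ⟨z, rfl⟩ := hK g
  obtain ⟨y, rfl⟩ := rTensor_surjective F hp z
  refine ⟨tensorBidual R Q F C y, LinearMap.ext fun φ => ?_⟩
  rw [LinearMap.comp_apply, tensorBidual_apply, tensorBidual_apply, lcomp_apply', rTensor_comp,
    LinearMap.comp_apply]

/-- Maps `K' ⟶ N ⊗ F` extend along `K' ⟶ Q` if maps `K' ⟶ N` do. -/
lemma exists_extension_tensor [Module.FinitePresentation R K'] [Module.Flat R F]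
    (hi : Function.Surjective (lcomp R N i)) (g : K' →ₗ[R] N ⊗[R] F) :
    ∃ g' : Q →ₗ[R] N ⊗[R] F, g' ∘ₗ i = g := by
  obtain ⟨x, rfl⟩ := rTensorHomToHomRTensor_surjective g
  obtain ⟨y, rfl⟩ := rTensor_surjective F hi x
  exact ⟨_, (rTensorHomToHomRTensor_lcomp i y).symm⟩

end

/-- Extension problems are preserved by tensoring with a projective module. -/
lemma exists_extension_rTensor [Module.Projective R P] {j : X →ₗ[R] Y}
    (hj : ∀ g : X →ₗ[R] H, ∃ g' : Y →ₗ[R] H, g' ∘ₗ j = g) (g : X ⊗[R] P →ₗ[R] H) :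
    ∃ g' : Y ⊗[R] P →ₗ[R] H, g' ∘ₗ j.rTensor P = g := by
  -- By adjunction the map is P ⟶ Hom(X, H), which lifts along the surjection Hom(Y, H) ⟶ Hom(X, H).
  obtain ⟨h, hh⟩ := Module.projective_lifting_property (lcomp R H j) (curry g).flip hj
  refine ⟨lift h.flip, TensorProduct.ext' fun x p => ?_⟩
  exact LinearMap.congr_fun (LinearMap.congr_fun hh p) x

end TensorHom

/-! ### Ext vanishing and coresolutions for modules -/

section Modules

open Limits

variable {R : Type u} [CommRing R] {C : Type u} [AddCommGroup C] [Module R C]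

lemma ModuleCat.shortExact_ofHom {X Y Z : Type u} [AddCommGroup X] [Module R X] [AddCommGroup Y]
    [Module R Y] [AddCommGroup Z] [Module R Z] {f : X →ₗ[R] Y} {g : Y →ₗ[R] Z}
    (hf : Function.Injective f) (hfg : Function.Exact f g) (hg : Function.Surjective g) :
    (ModuleCat.shortComplexOfCompEqZero f g hfg.linearMap_comp_eq_zero).ShortExact :=
  ModuleCat.shortComplex_shortExact _ hfg hf hg

/-- Tensoring a short exact sequence with a flat module. -/
lemma ModuleCat.shortExact_rTensor {S : ShortComplex (ModuleCat.{u} R)} (hS : S.ShortExact)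
    (P : Type u) [AddCommGroup P] [Module R P] [Module.Flat R P] :
    (ModuleCat.shortComplexOfCompEqZero (S.f.hom.rTensor P) (S.g.hom.rTensor P)
      (by rw [← LinearMap.rTensor_comp, ← ModuleCat.hom_comp, S.zero]; simp)).ShortExact :=
  ModuleCat.shortExact_ofHom
    (Module.Flat.rTensor_preserves_injective_linearMap _ hS.moduleCat_injective_f)
    (rTensor_exact P ((ShortComplex.ShortExact.moduleCat_exact_iff_function_exact S).1 hS.exact)
      hS.moduleCat_surjective_g)
    (LinearMap.rTensor_surjective P hS.moduleCat_surjective_g)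

variable (R C) in
/-- The class of the modules `C ⊗ F` with `F` flat, not closed under isomorphisms. -/
def tensorFlatModules : ObjectProperty (ModuleCat.{u} R) :=
  fun H => ∃ F : ModuleCat.{u} R, Module.Flat R F ∧ H = ModuleCat.of R (C ⊗[R] F)

lemma extOrthogonal_tensorFlatModules_le :
    extOrthogonal (tensorFlatModules R C) ≤ extOrthogonal (cFlatModules R C) := by
  rintro X hX H ⟨F, hF, ⟨e⟩⟩ n
  exact e.toModuleIso.retract.subsingleton_ext_to (X := X) (hX (.of R (C ⊗[R] F)) ⟨F, hF, rfl⟩ n)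

lemma lcomp_surjective_of_subsingleton_ext {S : ShortComplex (ModuleCat.{u} R)}
    (hS : S.ShortExact) (h : Subsingleton (Abelian.Ext S.X₃ (ModuleCat.of R C) 1)) :
    Function.Surjective (LinearMap.lcomp R C S.f.hom) := by
  intro f
  obtain ⟨g, hg⟩ := hS.exists_extension h (ModuleCat.ofHom f)
  exact ⟨g.hom, congrArg ModuleCat.Hom.hom hg⟩

/-- A class of modules closed under taking suitable syzygies, on which `Ext^n(-, C)` vanishes
for all `n ≥ 1`. -/
def IsSyzygyClass (C : Type u) [AddCommGroup C] [Module R C]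
    (𝓚 : ObjectProperty (ModuleCat.{u} R)) : Prop :=
  ∀ K, 𝓚 K → (∀ n : ℕ, Subsingleton (Abelian.Ext K (ModuleCat.of R C) (n + 1))) ∧
    ∃ S : ShortComplex (ModuleCat.{u} R), S.ShortExact ∧ S.X₃ = K ∧ Module.Finite R S.X₂ ∧
      Module.Projective R S.X₂ ∧ 𝓚 S.X₁

/-- The class consists of C and the images of the differentials in its resolution, restricted to
those with vanishing Ext into C; this vanishing passes to syzygies by dimension shifting. -/
lemma IsSemidualizing.exists_isSyzygyClass (hC : IsSemidualizing R C) :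
    ∃ 𝓚 : ObjectProperty (ModuleCat.{u} R), IsSyzygyClass C 𝓚 ∧ 𝓚 (ModuleCat.of R C) := by
  obtain ⟨P, hP⟩ := hC.exists_finite_resolution
  let 𝓚₀ : ObjectProperty (ModuleCat.{u} R) := fun K =>
    K = ModuleCat.of R C ∨ ∃ n, K = image (P.complex.d (n + 1) n)
  have h₀ (K) (hK : 𝓚₀ K) : ∃ S : ShortComplex (ModuleCat.{u} R), S.ShortExact ∧ S.X₃ = K ∧
      Module.Finite R S.X₂ ∧ Module.Projective R S.X₂ ∧ 𝓚₀ S.X₁ := by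
    have hproj (n : ℕ) : Module.Projective R (P.complex.X n) :=
      ModuleCat.projective_of_module_projective _
    obtain rfl | ⟨n, rfl⟩ := hK
    · have hS : (ShortComplex.mk (image.ι (P.complex.d 1 0)) (P.π.f 0)
          (image_ι_comp_eq_zero P.complex_d_comp_π_f_zero)).ShortExact :=
        { exact := exact_image_ι P.exact₀
          mono_f := inferInstanceAs (Mono (image.ι (P.complex.d 1 0)))
          epi_g := inferInstanceAs (Epi (P.π.f 0)) }
      exact ⟨_, hS, rfl, hP 0, hproj 0, .inr ⟨0, rfl⟩⟩
    · exact ⟨_, shortExact_image (P.exact_succ n), rfl, hP _, hproj _, .inr ⟨n + 1, rfl⟩⟩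
  refine ⟨fun K => 𝓚₀ K ∧ ∀ n : ℕ, Subsingleton (Abelian.Ext K (ModuleCat.of R C) (n + 1)),
    fun K hK => ⟨hK.2, ?_⟩, .inl rfl, fun n => hC.ext_subsingleton (n + 1) (by omega)⟩
  obtain ⟨S, hS, rfl, hf, hp, h₁⟩ := h₀ K hK.1
  exact ⟨S, hS, rfl, hf, hp, h₁, fun n =>
    hS.subsingleton_ext_left (Abelian.Ext.subsingleton_of_projective _ _ _) (hK.2 (n + 1))⟩

namespace IsSyzygyClass

variable {𝓚 : ObjectProperty (ModuleCat.{u} R)} (h𝓚 : IsSyzygyClass C 𝓚)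
include h𝓚

lemma finite {K : ModuleCat.{u} R} (hK : 𝓚 K) : Module.Finite R K := by
  obtain ⟨-, S, hS, rfl, _, _, -⟩ := h𝓚 K hK
  exact Module.Finite.of_surjective S.g.hom hS.moduleCat_surjective_g

lemma finitePresentation {K : ModuleCat.{u} R} (hK : 𝓚 K) : Module.FinitePresentation R K := by
  obtain ⟨-, S, hS, rfl, _, _, h₁⟩ := h𝓚 K hK
  have := h𝓚.finite h₁
  have : Module.FinitePresentation R S.X₂ := Module.finitePresentation_of_projective _ _
  refine Module.finitePresentation_of_surjective S.g.hom hS.moduleCat_surjective_g ?_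
  rw [← hS.exact.moduleCat_range_eq_ker, LinearMap.range_eq_map]
  exact Module.Finite.fg_top.map _

/-- Dimension shifting over the syzygies of K. In degree one, Ext^1(K, C) = 0 extends maps from the
syzygy to C; finite presentation and flatness carry this to C ⊗ F, and projectivity of P to the
tensor product with P. -/
lemma extOrthogonal_tensor {K : ModuleCat.{u} R} (hK : 𝓚 K) (P : Type u) [AddCommGroup P]
    [Module R P] [Module.Projective R P] :
    extOrthogonal (tensorFlatModules R C) (ModuleCat.of R (K ⊗[R] P)) := by
  rintro _ ⟨F, hF, rfl⟩ n
  induction n generalizing K with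
  | zero =>
    obtain ⟨hE, S, hS, rfl, _, _, h₁⟩ := h𝓚 K hK
    have := h𝓚.finitePresentation h₁
    refine (ModuleCat.shortExact_rTensor hS P).subsingleton_ext_one_right (fun f => ?_)
      (Abelian.Ext.subsingleton_of_projective _ _ _)
    obtain ⟨g, hg⟩ := exists_extension_rTensor (exists_extension_tensor
      (lcomp_surjective_of_subsingleton_ext hS (hE 0))) f.hom
    exact ⟨ModuleCat.ofHom g, ModuleCat.hom_ext hg⟩
  | succ n ih =>
    obtain ⟨-, S, hS, rfl, _, _, h₁⟩ := h𝓚 K hK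
    exact (ModuleCat.shortExact_rTensor hS P).subsingleton_ext_right (ih h₁)
      (Abelian.Ext.subsingleton_of_projective _ _ _)

end IsSyzygyClass

lemma IsSemidualizing.finitePresentation (hC : IsSemidualizing R C) :
    Module.FinitePresentation R C := by
  obtain ⟨𝓚, h𝓚, hK⟩ := hC.exists_isSyzygyClass
  exact h𝓚.finitePresentation hK

lemma cProjectiveModules_of_linearEquiv {M N : ModuleCat.{u} R} (e : M ≃ₗ[R] N)
    (hN : cProjectiveModules R C N) : cProjectiveModules R C M := by
  obtain ⟨P, hP, ⟨e'⟩⟩ := hN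
  exact ⟨P, hP, ⟨e.trans e'⟩⟩

lemma cProjectiveModules_le_cFlatModules : cProjectiveModules R C ≤ cFlatModules R C := by
  rintro M ⟨P, hP, e⟩
  exact ⟨P, inferInstance, e⟩

lemma cProjectiveModules_biprod {M N : ModuleCat.{u} R} (hM : cProjectiveModules R C M)
    (hN : cProjectiveModules R C N) : cProjectiveModules R C (M ⊞ N) := by
  obtain ⟨P, hP, ⟨e⟩⟩ := hM
  obtain ⟨P', hP', ⟨e'⟩⟩ := hN
  exact ⟨ModuleCat.of R (P × P'), inferInstanceAs (Module.Projective R (P × P')),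
    ⟨(ModuleCat.biprodIsoProd M N).toLinearEquiv ≪≫ₗ e.prodCongr e' ≪≫ₗ
      (TensorProduct.prodRight R R C P P').symm⟩⟩

/-- Finite projectivity of Q gives Hom(Q, C) ≅ C ⊗ Q*, and Q* ⊗ P is projective. -/
lemma cProjectiveModules_hom_tensor (Q P : Type u) [AddCommGroup Q] [Module R Q]
    [Module.Finite R Q] [Module.Projective R Q] [AddCommGroup P] [Module R P]
    [Module.Projective R P] :
    cProjectiveModules R C (ModuleCat.of R ((Q →ₗ[R] C) ⊗[R] P)) :=
  ⟨ModuleCat.of R (Module.Dual R Q ⊗[R] P),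
    inferInstanceAs (Module.Projective R (Module.Dual R Q ⊗[R] P)),
    ⟨TensorProduct.congr ((LinearEquiv.ofBijective _ dualTensorHom_bijective).symm ≪≫ₗ
      TensorProduct.comm R _ _) (.refl R P) ≪≫ₗ TensorProduct.assoc R _ _ _⟩⟩

lemma IsSemidualizing.cProjectiveModules_le_extOrthogonal (hC : IsSemidualizing R C) :
    cProjectiveModules R C ≤ extOrthogonal (cFlatModules R C) := by
  rintro M ⟨P, hP, ⟨e⟩⟩
  obtain ⟨𝓚, h𝓚, hK⟩ := hC.exists_isSyzygyClass
  exact extOrthogonal_of_iso (Y := ModuleCat.of R (C ⊗[R] P)) e.toModuleIso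
    (extOrthogonal_tensorFlatModules_le _ (h𝓚.extOrthogonal_tensor hK P))

lemma tensorFlatModules_le_cFlatModules : tensorFlatModules R C ≤ cFlatModules R C := by
  rintro _ ⟨F, hF, rfl⟩
  exact ⟨F, hF, ⟨.refl R _⟩⟩

/-- Applying `Hom(-, C) ⊗ P` to a short exact sequence preserved by `Hom(-, C)`. -/
lemma ModuleCat.shortExact_lcomp_rTensor {S : ShortComplex (ModuleCat.{u} R)} (hS : S.ShortExact)
    (h : Function.Surjective (LinearMap.lcomp R C S.f.hom))
    (P : Type u) [AddCommGroup P] [Module R P] [Module.Flat R P] :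
    (ModuleCat.shortComplexOfCompEqZero ((LinearMap.lcomp R C S.g.hom).rTensor P)
      ((LinearMap.lcomp R C S.f.hom).rTensor P) (by
        rw [← LinearMap.rTensor_comp, (lcomp_exact
          ((ShortComplex.ShortExact.moduleCat_exact_iff_function_exact S).1 hS.exact)
          hS.moduleCat_surjective_g).linearMap_comp_eq_zero, LinearMap.rTensor_zero])).ShortExact :=
  ModuleCat.shortExact_rTensor (ModuleCat.shortExact_ofHom
    (lcomp_injective (N := C) hS.moduleCat_surjective_g)
    (lcomp_exact ((ShortComplex.ShortExact.moduleCat_exact_iff_function_exact S).1 hS.exact)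
      hS.moduleCat_surjective_g) h) P

/-- Passes orthogonality from one cosyzygy to the next; the middle term is C-projective, and
surjectivity of the bidual map supplies the extensions needed in degree one. -/
lemma IsSemidualizing.extOrthogonal_hom_tensor (hC : IsSemidualizing R C)
    {S : ShortComplex (ModuleCat.{u} R)} (hS : S.ShortExact) [Module.Finite R S.X₂]
    [Module.Projective R S.X₂] (h : Function.Surjective (LinearMap.lcomp R C S.f.hom))
    (hbi : ∀ F : ModuleCat.{u} R, Module.Flat R F →
      Function.Surjective (tensorBidual R S.X₃ F C))
    (P : Type u) [AddCommGroup P] [Module R P] [Module.Projective R P]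
    (h₃ : extOrthogonal (tensorFlatModules R C) (ModuleCat.of R ((S.X₃ →ₗ[R] C) ⊗[R] P))) :
    extOrthogonal (tensorFlatModules R C) (ModuleCat.of R ((S.X₁ →ₗ[R] C) ⊗[R] P)) := by
  refine extOrthogonal_right (ModuleCat.shortExact_lcomp_rTensor hS h P) h₃ (fun H hH n => ?_) ?_
  · exact hC.cProjectiveModules_le_extOrthogonal _ (cProjectiveModules_hom_tensor S.X₂ P) H
      (tensorFlatModules_le_cFlatModules _ hH) n
  · rintro _ ⟨F, hF, rfl⟩ f
    obtain ⟨g, hg⟩ := exists_extension_rTensor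
      (exists_extension_lcomp hS.moduleCat_surjective_g (hbi F hF)) f.hom
    exact ⟨ModuleCat.ofHom g, ModuleCat.hom_ext hg⟩

/-- Projective modules have coresolutions by `C`-projective modules. -/
lemma IsSemidualizing.coresolvedClass_of_projective (hC : IsSemidualizing R C)
    (P : ModuleCat.{u} R) [Module.Projective R P] :
    coresolvedClass (cProjectiveModules R C) (cFlatModules R C) P := by
  obtain ⟨𝓚, h𝓚, hCK⟩ := hC.exists_isSyzygyClass
  have hfp := hC.finitePresentation
  let e : P ≃ₗ[R] (C →ₗ[R] C) ⊗[R] P := (TensorProduct.lid R P).symm ≪≫ₗ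
    TensorProduct.congr (LinearEquiv.ofBijective (LinearMap.lsmul R C : R →ₗ[R] C →ₗ[R] C)
      hC.homothety_bijective) (.refl R P)
  have he : Module.Projective R ((C →ₗ[R] C) ⊗[R] P) := Module.Projective.of_equiv e
  -- Bijectivity of the bidual map is carried along with orthogonality: its surjectivity gives
  -- orthogonality of the next cosyzygy, its injectivity gives bijectivity for the next syzygy.
  let 𝓦 : ObjectProperty (ModuleCat.{u} R) := fun W =>
    extOrthogonal (tensorFlatModules R C) W ∧ ∃ K : ModuleCat.{u} R, 𝓚 K ∧
    (∀ F : ModuleCat.{u} R, Module.Flat R F → Function.Bijective (tensorBidual R K F C)) ∧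
    W = ModuleCat.of R ((K →ₗ[R] C) ⊗[R] P)
  have h𝓦 : 𝓦 (ModuleCat.of R ((C →ₗ[R] C) ⊗[R] P)) :=
    ⟨extOrthogonal_of_projective _, ModuleCat.of R C, hCK,
      fun F _ => tensorBidual_self_bijective hC.homothety_bijective, rfl⟩
  refine .of_iso (Y := ModuleCat.of R ((C →ₗ[R] C) ⊗[R] P)) e.toModuleIso
    ⟨𝓦, fun W hW => extOrthogonal_tensorFlatModules_le _ hW.1, h𝓦, ?_⟩
  rintro _ ⟨hW, K, hK, hbi, rfl⟩
  obtain ⟨hE, S, hS, rfl, _, _, h₁⟩ := h𝓚 K hK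
  have hsurj := lcomp_surjective_of_subsingleton_ext hS (hE 0)
  have hbi₁ (F : ModuleCat.{u} R) (hF : Module.Flat R F) :
      Function.Bijective (tensorBidual R S.X₁ F C) :=
    tensorBidual_bijective_of_exact hS.moduleCat_injective_f
      ((ShortComplex.ShortExact.moduleCat_exact_iff_function_exact S).1 hS.exact)
      hS.moduleCat_surjective_g hsurj (hbi F hF).1
      (tensorBidual_bijective_of_projective hC.homothety_bijective)
  exact ⟨_, _, _, _, _, ModuleCat.shortExact_lcomp_rTensor hS hsurj P,
    cProjectiveModules_hom_tensor _ _,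
    hC.extOrthogonal_hom_tensor hS hsurj (fun F hF => (hbi F hF).2) P hW, S.X₁, h₁, hbi₁, rfl⟩

end Modules

/-! ### From modules to complexes -/

section Complexes

open Limits

variable {R : Type u} [CommRing R] {C : Type u} [AddCommGroup C] [Module R C]
  {𝓧 : ObjectProperty (ModuleCat.{u} R)}

instance : (projectiveModules R).IsClosedUnderIsomorphisms where
  of_iso e (_ : Module.Projective R _) := Module.Projective.of_equiv e.toLinearEquiv

instance : (cProjectiveModules R C).IsClosedUnderIsomorphisms where
  of_iso e h := cProjectiveModules_of_linearEquiv e.symm.toLinearEquiv h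

instance : (cFlatModules R C).IsClosedUnderIsomorphisms where
  of_iso e := fun ⟨F, hF, ⟨e'⟩⟩ => ⟨F, hF, ⟨e.symm.toLinearEquiv.trans e'⟩⟩

lemma complexesOf_mono {𝓨 : ObjectProperty (ModuleCat.{u} R)} (h : 𝓧 ≤ 𝓨) :
    complexesOf 𝓧 ≤ complexesOf 𝓨 :=
  fun _ hX => ⟨hX.1, fun i => h _ (hX.2 i)⟩

lemma complexesOf_diskSum [𝓧.IsClosedUnderIsomorphisms] {M : ℤ → ModuleCat.{u} R}
    (hM : ∀ i, 𝓧 (M i)) : complexesOf 𝓧 (diskSum M) :=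
  ⟨diskSum.acyclic M, fun i => 𝓧.prop_of_iso (diskSum.cyclesIso M i).symm (hM _)⟩

lemma complexesOf_of_retract {X Y : ChainComplex (ModuleCat.{u} R) ℤ} (h : Retract X Y)
    (h𝓧 : ∀ {M N : ModuleCat.{u} R}, Retract M N → 𝓧 N → 𝓧 M) (hY : complexesOf 𝓧 Y) :
    complexesOf 𝓧 X := by
  refine ⟨fun i => ?_, fun i => h𝓧 (h.map (HomologicalComplex.cyclesFunctor _ _ i)) (hY.2 i)⟩
  rw [HomologicalComplex.exactAt_iff_isZero_homology]
  have h' := h.map (HomologicalComplex.homologyFunctor _ _ i)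
  have hz : IsZero ((HomologicalComplex.homologyFunctor (ModuleCat.{u} R) (ComplexShape.down ℤ)
    i).obj Y) := (hY.1 i).isZero_homology
  exact (IsZero.iff_id_eq_zero _).2
    (h'.retract.symm.trans (by rw [hz.eq_of_tgt h'.i 0, zero_comp]; rfl))

instance cyclesFunctor_additive (i : ℤ) :
    (HomologicalComplex.cyclesFunctor (ModuleCat.{u} R) (ComplexShape.down ℤ) i).Additive where
  map_add {X Y f g} := by
    change HomologicalComplex.cyclesMap (f + g) i =
      HomologicalComplex.cyclesMap f i + HomologicalComplex.cyclesMap g i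
    rw [← cancel_mono (Y.iCycles i)]
    simp

lemma complexesOf_biprod {X Y : ChainComplex (ModuleCat.{u} R) ℤ}
    [𝓧.IsClosedUnderIsomorphisms]
    (h𝓧 : ∀ {M N : ModuleCat.{u} R}, 𝓧 M → 𝓧 N → 𝓧 (M ⊞ N)) (hX : complexesOf 𝓧 X)
    (hY : complexesOf 𝓧 Y) : complexesOf 𝓧 (X ⊞ Y) := by
  constructor
  · intro i
    rw [HomologicalComplex.exactAt_iff_isZero_homology]
    have := preservesBinaryBiproducts_of_preservesBiproducts
      (HomologicalComplex.homologyFunctor (ModuleCat.{u} R) (ComplexShape.down ℤ) i)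
    refine IsZero.of_iso ?_
      ((HomologicalComplex.homologyFunctor (ModuleCat.{u} R) _ i).mapBiprod X Y)
    exact (IsZero.iff_id_eq_zero _).2 (biprod.hom_ext _ _
      ((hX.1 i).isZero_homology.eq_of_tgt _ _) ((hY.1 i).isZero_homology.eq_of_tgt _ _))
  · intro i
    have := preservesBinaryBiproducts_of_preservesBiproducts
      (HomologicalComplex.cyclesFunctor (ModuleCat.{u} R) (ComplexShape.down ℤ) i)
    exact 𝓧.prop_of_iso
      ((HomologicalComplex.cyclesFunctor (ModuleCat.{u} R) _ i).mapBiprod X Y).symm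
      (h𝓧 (hX.2 i) (hY.2 i))

lemma complexesOf_opcycles [𝓧.IsClosedUnderIsomorphisms]
    {X : ChainComplex (ModuleCat.{u} R) ℤ} (hX : complexesOf 𝓧 X) (i : ℤ) :
    𝓧 (X.opcycles i) := by
  obtain ⟨j, rfl⟩ : ∃ j, i = j + 1 := ⟨i - 1, by omega⟩
  exact 𝓧.prop_of_iso (hX.1.cyclesIso j) (hX.2 j)

/-- The short exact sequences of opcycles have both ends in 𝓧, so the vanishing of Ext^1 splits
them. -/
lemma exists_iso_diskSum [𝓧.IsClosedUnderIsomorphisms]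
    (h𝓧 : ∀ M N, 𝓧 M → 𝓧 N → Subsingleton (Abelian.Ext M N 1))
    {X : ChainComplex (ModuleCat.{u} R) ℤ} (hX : complexesOf 𝓧 X) :
    ∃ M : ℤ → ModuleCat.{u} R, (∀ i, 𝓧 (M i)) ∧ Nonempty (X ≅ diskSum M) := by
  have hop := complexesOf_opcycles hX
  refine ⟨_, hop, hX.1.nonempty_iso_diskSum fun i => ?_⟩
  have hS := hX.1.shortExact_opcycles i
  obtain ⟨r, hr⟩ := hS.exists_extension (h𝓧 _ _ (hop i) (hop (i + 1))) (𝟙 _)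
  have : Epi (X.pOpcycles i) := inferInstance
  exact IsSplitEpi.mk' (ShortComplex.Splitting.ofExactOfRetraction _ hS.exact r hr this).splitEpi_g

lemma complexesOf_projectiveModules_iff (X : ChainComplex (ModuleCat.{u} R) ℤ) :
    complexesOf (projectiveModules R) X ↔ Projective X := by
  constructor
  · intro hX
    obtain ⟨M, hM, ⟨e⟩⟩ := exists_iso_diskSum (𝓧 := projectiveModules R)
      (fun M N (hM : Module.Projective R M) _ =>
        Abelian.Ext.subsingleton_of_projective M N 0) hX
    have (i : ℤ) : Projective (M i) :=
      have : Module.Projective R (M i) := hM i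
      inferInstance
    exact Projective.of_iso e.symm inferInstance
  · intro hX
    let f := diskSum.desc fun i => Projective.π (X.X i)
    have : Epi f := diskSum.epi_desc _
    -- A projective complex is a retract of the sum of disks on projective covers of its terms.
    refine complexesOf_of_retract ⟨Projective.factorThru (𝟙 X) f, f, by simp⟩
      (fun h (_ : Module.Projective R _) => ?_) (complexesOf_diskSum fun i => ?_)
    · exact Module.Projective.of_split h.i.hom h.r.hom (congrArg ModuleCat.Hom.hom h.retract)
    · exact ModuleCat.projective_of_module_projective (Projective.over (X.X i))

variable [HasExt.{u} (ChainComplex (ModuleCat.{u} R) ℤ)]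

/-- Each term of a C-flat complex is an extension of two C-flat opcycle modules, so orthogonality to
C-flat modules suffices; the term itself need not be known to be C-flat. -/
lemma diskSum.extOrthogonal_cFlat {M : ℤ → ModuleCat.{u} R}
    (hM : ∀ i, extOrthogonal (cFlatModules R C) (M i)) :
    extOrthogonal (complexesOf (cFlatModules R C)) (diskSum M) := by
  intro H hH n
  refine diskSum.subsingleton_ext (fun i n => ?_) n
  exact (hH.1.shortExact_opcycles i).subsingleton_ext_to_middle
    (hM i _ (complexesOf_opcycles hH (i + 1)) n) (hM i _ (complexesOf_opcycles hH i) n)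

/-- Coresolutions of the generators assemble degreewise, since sums of disks preserve short exact
sequences. -/
lemma diskSum.coresolvedClass {M : ℤ → ModuleCat.{u} R}
    (hM : ∀ i, coresolvedClass (cProjectiveModules R C) (cFlatModules R C) (M i)) :
    coresolvedClass (complexesOf (cProjectiveModules R C)) (complexesOf (cFlatModules R C))
      (diskSum M) := by
  refine ⟨fun W => ∃ M : ℤ → ModuleCat.{u} R,
    (∀ i, _root_.coresolvedClass (cProjectiveModules R C) (cFlatModules R C) (M i)) ∧
    W = diskSum M, ?_, ⟨M, hM, rfl⟩, ?_⟩
  · rintro _ ⟨M, hM, rfl⟩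
    exact extOrthogonal_cFlat fun i => coresolvedClass_le _ (hM i)
  · rintro _ ⟨M, hM, rfl⟩
    choose Q N f g w hS hQ hN using fun i => (hM i).exists_shortExact
    exact ⟨diskSum Q, diskSum N, _, _, _, diskSum.shortExact_map hS, complexesOf_diskSum hQ,
      N, hN, rfl⟩

namespace IsSemidualizing

variable (hC : IsSemidualizing R C)
include hC

lemma complexesOf_cProjectiveModules_le_extOrthogonal :
    complexesOf (cProjectiveModules R C) ≤ extOrthogonal (complexesOf (cFlatModules R C)) := by
  intro X hX
  obtain ⟨M, hM, ⟨e⟩⟩ := exists_iso_diskSum (fun M N hM hN =>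
    hC.cProjectiveModules_le_extOrthogonal M hM N (cProjectiveModules_le_cFlatModules _ hN) 0) hX
  exact extOrthogonal_of_iso e (diskSum.extOrthogonal_cFlat fun i =>
    hC.cProjectiveModules_le_extOrthogonal _ (hM i))

lemma coresolvedClass_of_complexesOf_projective {X : ChainComplex (ModuleCat.{u} R) ℤ}
    (hX : complexesOf (projectiveModules R) X) :
    coresolvedClass (complexesOf (cProjectiveModules R C)) (complexesOf (cFlatModules R C)) X := by
  obtain ⟨M, hM, ⟨e⟩⟩ := exists_iso_diskSum (𝓧 := projectiveModules R)
    (fun M N (hM : Module.Projective R M) _ => Abelian.Ext.subsingleton_of_projective M N 0) hX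
  refine .of_iso e (diskSum.coresolvedClass fun i => ?_)
  have : Module.Projective R (M i) := hM i
  exact hC.coresolvedClass_of_projective (M i)

lemma dcProjectiveComplexes_iff (X : ChainComplex (ModuleCat.{u} R) ℤ) :
    dcProjectiveComplexes R C X ↔ coresolvedClass (complexesOf (cProjectiveModules R C))
      (complexesOf (cFlatModules R C)) X := by
  constructor
  · refine completelyResolved.coresolvedClass (𝓟 := complexesOf (projectiveModules R))
      (fun P hP => ?_) hC.complexesOf_cProjectiveModules_le_extOrthogonal
    have := (complexesOf_projectiveModules_iff P).1 hP
    exact extOrthogonal_of_projective P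
  · exact coresolvedClass.completelyResolved (𝓟 := complexesOf (projectiveModules R))
      fun P hP => (complexesOf_projectiveModules_iff P).2 hP

end IsSemidualizing

end Complexes

theorem corollary2p10 (R : Type u) [CommRing R] (C : Type u) [AddCommGroup C] [Module R C]
    (hC : IsSemidualizing R C) :
    IsProjectivelyResolving (dcProjectiveComplexes R C) ∧
      ∀ X : ChainComplex (ModuleCat.{u} R) ℤ,
        complexesOf (projectiveModules R) X → dcProjectiveComplexes R C X := by
  have : HasExt.{u} (ChainComplex (ModuleCat.{u} R) ℤ) := hasExt_of_enoughProjectives _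
  have hP (X : ChainComplex (ModuleCat.{u} R) ℤ) (hX : complexesOf (projectiveModules R) X) :
      dcProjectiveComplexes R C X :=
    (hC.dcProjectiveComplexes_iff X).2 (hC.coresolvedClass_of_complexesOf_projective hX)
  have hQH := complexesOf_mono (cProjectiveModules_le_cFlatModules (R := R) (C := C))
  have hQ (X Y) (hX : complexesOf (cProjectiveModules R C) X)
      (hY : complexesOf (cProjectiveModules R C) Y) :=
    complexesOf_biprod cProjectiveModules_biprod hX hY
  refine ⟨⟨fun P h => hP P ((complexesOf_projectiveModules_iff P).2 h), fun S hS h₃ => ?_⟩, hP⟩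
  rw [hC.dcProjectiveComplexes_iff] at h₃ ⊢
  rw [hC.dcProjectiveComplexes_iff]
  exact ⟨fun h₂ => .left hQH hQ hS h₂ h₃, fun h₁ => .middle hQH hQ hS h₁ h₃⟩
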